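/- Let $G=(V,E)$ be an infinite, countable, connected, locally finite graph, and let $I$ be either $E$ (bond percolation) or $V$ (site percolation). A configuration declares each element of $I$ open or closed; an infinite cluster is an infinite connected component of the graph formed by all vertices and the open edges (for bonds), respectively of the subgraph induced by the open vertices (for sites). For $p\in[0,1]$ let $\mathbb P_p$ be the law under which the elements of $I$ are open independently with probability $p$, and let $p_c=\sup\{p\in[0,1]:\mathbb P_p[\exists\text{ an infinite cluster}]=0\}$ (for the model considered). Let $K:I\times I\to[0,\infty)$ be a symmetric transition matrix, i.e. $K(i,j)=K(j,i)$ and $\sum_{j}K(i,j)=1$ for all $i$. The $K$-exclusion dynamical percolation of parameter $p$ is the process $(\omega_K(t))_{t\ge 0}$ with $\omega_K(0)\sim\mathbb P_p$ obtained as follows: each pair $\{i,j\}\subseteq I$ carries a clock whose successive waiting times are exponential of parameter $K(i,j)$ (the clock never rings if $K(i,j)=0$), all clocks and $\omega_K(0)$ being independent; whenever the clock of $\{i,j\}$ rings, the states of $i$ and $j$ are exchanged. A time $t\ge 0$ is exceptional if either $\mathbb P_p[\exists\text{ an infinite cluster}]=0$ and $\omega_K(t)$ has an infinite cluster, or $\mathbb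 P_p[\exists\text{ an infinite cluster}]=1$ and $\omega_K(t)$ has no infinite cluster. Then, for bond percolation as well as for site percolation, for every such $K$ and every $p\in[0,1]$ with $p\neq p_c$, almost surely there is no exceptional time $t\ge 0$ for the $K$-exclusion dynamical percolation of parameter $p$. -/

import Mathlib

open MeasureTheory ProbabilityTheory

universe u w

namespace ExclusionPercolation

/-! ### Static percolation

Configurations on a set `ι` of sites or bonds are functions `ι → Bool`; `true` means open and
`false` means closed. -/

/-- The percolation measure of parameter `p`: every `i : ι` is open with probability `p` and closed
with probability `1 - p`, independently of the others. -/
noncomputable def percMeasure (ι : Type*) (p : unitInterval) : Measure (ι → Bool) :=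
  Measure.infinitePi fun _ : ι => bernoulliMeasure true false p

/-- The graph obtained from `G` by keeping all vertices and only the open edges. -/
def openBondGraph {V : Type*} (G : SimpleGraph V) (η : G.edgeSet → Bool) : SimpleGraph V :=
  SimpleGraph.fromEdgeSet {e | ∃ h : e ∈ G.edgeSet, η ⟨e, h⟩ = true}

/-- Bond percolation: some connected component of the graph of open edges is infinite. -/
def HasInfiniteBondCluster {V : Type*} (G : SimpleGraph V) (η : G.edgeSet → Bool) : Prop :=
  ∃ C : (openBondGraph G η).ConnectedComponent, C.supp.Infinite

/-- Site percolation: some connected component of the subgraph induced by the open vertices is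
infinite. -/
def HasInfiniteSiteCluster {V : Type*} (G : SimpleGraph V) (η : V → Bool) : Prop :=
  ∃ C : (G.induce {v | η v = true}).ConnectedComponent, C.supp.Infinite

/-- The critical point: the supremum of the parameters for which almost surely there is no infinite
cluster. The predicate `Inf` says that a configuration has an infinite cluster. -/
noncomputable def criticalPoint {ι : Type*} (Inf : (ι → Bool) → Prop) : ℝ :=
  sSup {q : ℝ | ∃ h : q ∈ unitInterval, percMeasure ι ⟨q, h⟩ {η | Inf η} = 0}

/-- `η` is exceptional at parameter `p`: it has an infinite cluster although this has probability
zero under the percolation measure, or it has none although this has probability one. -/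
def IsExceptional {ι : Type*} (Inf : (ι → Bool) → Prop) (p : unitInterval) (η : ι → Bool) : Prop :=
  (percMeasure ι p {ζ | Inf ζ} = 0 ∧ Inf η) ∨ (percMeasure ι p {ζ | Inf ζ} = 1 ∧ ¬ Inf η)

/-! ### The exclusion dynamics -/

/-- Symmetric transition matrices: nonnegative entries, all row sums equal to one, symmetric. -/
structure IsSymmTransitionMatrix {ι : Type*} (K : ι → ι → ℝ) : Prop where
  nonneg : ∀ i j, 0 ≤ K i j
  hasSum_row : ∀ i, HasSum (K i) 1
  symm : ∀ i j, K i j = K j i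

/-- The set of times at which the clock of the pair `{i, j}` rings, where `W s 0, W s 1, …` are the
successive waiting times of the clock of the pair `s`. A clock of rate zero never rings. -/
def ringTimes {ι : Type*} (K : ι → ι → ℝ) (W : Sym2 ι → ℕ → ℝ) (i j : ι) : Set ℝ :=
  {t | 0 < K i j ∧ ∃ n : ℕ, t = ∑ m ∈ Finset.range (n + 1), W s(i, j) m}

/-- `JumpsTo R i τ j`: the particle that starts at `i` at time `0` is at `j` just after its last
jump so far, which took place at time `τ` (with `τ = 0`, `j = i` before the first jump). When a
particle has arrived in `j` at time `τ`, its next jump is at the first time `σ > τ` at which a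
clock of some pair `{j, k}` rings, and it goes to the other element `k` of this pair.
Here `R j k` is the set of ringing times of the clock of `{j, k}`. -/
inductive JumpsTo {ι : Type*} (R : ι → ι → Set ℝ) (i : ι) : ℝ → ι → Prop
  | start : JumpsTo R i 0 i
  | jump {τ σ : ℝ} {j k : ι} : JumpsTo R i τ j → τ < σ → σ ∈ R j k →
      (∀ l, ∀ r ∈ R j l, ¬ (τ < r ∧ r < σ)) → JumpsTo R i σ k

/-- `MovesTo R i t j`: the particle that starts at `i` at time `0` is at `j` at time `t`, after
finitely many jumps. -/
def MovesTo {ι : Type*} (R : ι → ι → Set ℝ) (i : ι) (t : ℝ) (j : ι) : Prop :=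
  ∃ τ ≤ t, JumpsTo R i τ j ∧ ∀ l, ∀ r ∈ R j l, ¬ (τ < r ∧ r ≤ t)

open Classical in
/-- The configuration at time `t` of the exclusion process with initial configuration `η`: states
are carried along the motion, so that `j` is open at time `t` if and only if it is the position at
time `t` of a particle whose starting point was open. -/
noncomputable def exclusionState {ι : Type*} (R : ι → ι → Set ℝ) (η : ι → Bool) (t : ℝ) :
    ι → Bool :=
  fun j => decide (∃ i, MovesTo R i t j ∧ η i = true)

/-- The random input of the exclusion process at equilibrium: `η₀` has the law of percolation of
parameter `p`, and the clock of every pair `{i, j}` with `K i j > 0` has exponential waiting times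
of parameter `K i j`; all waiting times of all clocks and `η₀` are independent. -/
structure IsEquilibriumInput {ι Ω : Type*} [MeasurableSpace Ω] (μ : Measure Ω) (K : ι → ι → ℝ)
    (p : unitInterval) (η₀ : Ω → ι → Bool) (W : Sym2 ι → ℕ → Ω → ℝ) : Prop where
  measurable_init : Measurable η₀
  measurable_wait : ∀ s n, Measurable (W s n)
  law_init : μ.map η₀ = percMeasure ι p
  law_wait : ∀ i j, 0 < K i j → ∀ n, μ.map (W s(i, j) n) = expMeasure (K i j)
  indep_wait : iIndepFun (fun (q : Sym2 ι × ℕ) => W q.1 q.2) μ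
  indep_init : IndepFun η₀ (fun x (q : Sym2 ι × ℕ) => W q.1 q.2 x) μ

/-- The exclusion process built from a random input. -/
noncomputable def exclusionProcess {ι Ω : Type*} (K : ι → ι → ℝ) (η₀ : Ω → ι → Bool)
    (W : Sym2 ι → ℕ → Ω → ℝ) (t : ℝ) (x : Ω) : ι → Bool :=
  exclusionState (ringTimes K fun s n => W s n x) (η₀ x) t

/-- Almost surely, the `K`-exclusion dynamical percolation of parameter `p` has no exceptional time,
whatever the probability space on which it is realized. -/
def NoExceptionalTimes {ι : Type u} (Inf : (ι → Bool) → Prop) (K : ι → ι → ℝ)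
    (p : unitInterval) : Prop :=
  ∀ (Ω : Type w) [MeasurableSpace Ω] (μ : Measure Ω) [IsProbabilityMeasure μ]
    (η₀ : Ω → ι → Bool) (W : Sym2 ι → ℕ → Ω → ℝ), IsEquilibriumInput μ K p η₀ W →
    ∀ᵐ x ∂μ, ∀ t : ℝ, 0 ≤ t → ¬ IsExceptional Inf p (exclusionProcess K η₀ W t x)

end ExclusionPercolation

/-! Cut time into windows of length `δ`. Between `nδ` and `nδ + δ` the state of an element changes
only if a clock of a pair containing it rings. The configuration at any time of the window therefore
lies between two modifications of the one at time `nδ`: all elements of ringing pairs closed, or all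
of them opened. By monotonicity the uncountably many times reduce to countably many `n`: below
criticality the opened configuration must have no infinite cluster almost surely, above criticality
the closed one must still have one.

At time `nδ` the configuration has the law of percolation and is independent of all clocks, past and
future: given the clocks, it is the initial configuration read through an injection
(`exists_injective_exclusionState_eq`, `map_exclusionProcess_waits`). The pairs ringing in the
window are independent, with at most `δ` of them at each element on average, because the rows of `K`
sum to one (`pairRateLe_ringProb`). What remains is a static question about percolation with sparse
independent pairs opened.

Opening both elements of a pair correlates them, but a base density `c > 0` absorbs this: opening a
pair with probability `r` is dominated by raising both densities by `r / c`
(`pair_open_inequality`). Adding up, density `c + δ / c` dominates (`openPairs_univ_le`), which for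
small `δ` stays on the same side of the critical point; the supercritical case follows by exchanging
open and closed. Domination is proved for clopen increasing events and passes to percolation by
monotone limits (`IsPercolationEvent.measure_le`).

The motion itself is controlled by a path count: in a window shorter than 1 the ringing pairs form
finite clusters (`PairRateLe.ae_exists_finite`), so every position can be traced back to a starting
point (`IsFiniteWindow.exists_movesTo`). -/

namespace ExclusionPercolation

/-! ### Inhomogeneous product measures -/

/-- Every `i` is open with probability `p i`, independently of the others. -/
noncomputable def bernoulliProduct {ι : Type*} (p : ι → unitInterval) : Measure (ι → Bool) :=
  Measure.infinitePi fun i : ι => bernoulliMeasure true false (p i)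

instance {ι : Type*} (p : ι → unitInterval) : IsProbabilityMeasure (bernoulliProduct p) := by
  unfold bernoulliProduct; infer_instance

theorem percMeasure_eq_bernoulliProduct (ι : Type*) (p : unitInterval) :
    percMeasure ι p = bernoulliProduct fun _ => p := rfl

instance {ι : Type*} (p : unitInterval) : IsProbabilityMeasure (percMeasure ι p) := by
  rw [percMeasure_eq_bernoulliProduct]; infer_instance

theorem measurable_decide_of_measurableSet {α : Type*} [MeasurableSpace α] {P : α → Prop}
    [DecidablePred P] (h : MeasurableSet {a | P a}) : Measurable fun a => decide (P a) := by
  refine measurable_to_bool ?_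
  convert h using 1
  ext a; simp

theorem measurable_update_prod {ι : Type*} [DecidableEq ι] (j : ι) :
    Measurable (fun z : Bool × (ι → Bool) => Function.update z.2 j z.1) := by
  refine measurable_pi_lambda _ fun i => ?_
  by_cases h : i = j
  · subst h; simpa using measurable_fst
  · simp only [Function.update_of_ne h]
    fun_prop

theorem bernoulliMeasure_true_false_apply_true (r : unitInterval) :
    bernoulliMeasure true false r {true} = ENNReal.ofReal r := by
  rw [bernoulliMeasure_apply _ (measurableSet_singleton _)]
  simp [ENNReal.ofReal, unitInterval.toNNReal]
  exact congrArg _ (Real.toNNReal_of_nonneg r.2.1).symm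

theorem eq_bernoulliMeasure {ν : Measure Bool} [IsProbabilityMeasure ν] {r : unitInterval}
    (h : ν {true} = ENNReal.ofReal r) : ν = bernoulliMeasure true false r := by
  rw [← bernoulliMeasure_true_false_apply_true] at h
  refine Measure.ext_of_singleton fun b => ?_
  cases b with
  | true => exact h
  | false =>
    have h' : ({false} : Set Bool) = {true}ᶜ := by ext b; cases b <;> simp
    rw [h', prob_compl_eq_one_sub (measurableSet_singleton _),
      prob_compl_eq_one_sub (measurableSet_singleton _), h]

theorem map_le_uniform (p : unitInterval) :
    (volume : Measure unitInterval).map (fun u => decide (u ≤ p)) =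
      bernoulliMeasure true false p := by
  have hm : Measurable (fun u : unitInterval => decide (u ≤ p)) :=
    measurable_decide_of_measurableSet measurableSet_Iic
  have : IsProbabilityMeasure ((volume : Measure unitInterval).map
      (fun u => decide (u ≤ p))) := Measure.isProbabilityMeasure_map hm.aemeasurable
  refine eq_bernoulliMeasure ?_
  rw [Measure.map_apply hm (measurableSet_singleton _), ← unitInterval.volume_Iic]
  congr 1
  ext u
  simp

/-- Couple all densities through one family of uniform variables, calling `i` open when its uniform
variable is at most the density. -/
theorem bernoulliProduct_mono {ι : Type*} {p q : ι → unitInterval} (hpq : p ≤ q)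
    {B : Set (ι → Bool)} (hB : MeasurableSet B) (hup : IsUpperSet B) :
    bernoulliProduct p B ≤ bernoulliProduct q B := by
  have key : ∀ r : ι → unitInterval, bernoulliProduct r =
      (Measure.infinitePi fun _ : ι => (volume : Measure unitInterval)).map
        (fun u i => decide (u i ≤ r i)) := by
    intro r
    rw [Measure.infinitePi_map_pi (μ := fun _ : ι => (volume : Measure unitInterval))
      (f := fun i (u : unitInterval) => decide (u ≤ r i))
      (fun i => measurable_decide_of_measurableSet measurableSet_Iic)]
    simp_rw [map_le_uniform]
    rfl
  have hm : ∀ r : ι → unitInterval,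
      Measurable (fun (u : ι → unitInterval) i => decide (u i ≤ r i)) := by
    intro r
    refine measurable_pi_lambda _ fun i => ?_
    exact (measurable_decide_of_measurableSet (measurableSet_Iic (a := r i))).comp (measurable_pi_apply i)
  rw [key p, key q, Measure.map_apply (hm p) hB, Measure.map_apply (hm q) hB]
  refine measure_mono fun u hu => hup ?_ hu
  intro i
  by_cases h : u i ≤ p i
  · have := h.trans (hpq i)
    simp [h, this]
  · simp [h]

theorem bernoulliProduct_map_not {ι : Type*} (p : ι → unitInterval) :
    (bernoulliProduct p).map (fun x i => !x i) =
      bernoulliProduct fun i => unitInterval.symm (p i) := by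
  unfold bernoulliProduct
  rw [Measure.infinitePi_map_pi (μ := fun i : ι => bernoulliMeasure true false (p i))
    (f := fun _ b => !b) (fun i => measurable_of_countable _)]
  congr 1
  funext i
  rw [map_bernoulliMeasure]
  simp [bernoulliMeasure_def, add_comm]

theorem bernoulliProduct_update {ι : Type*} [DecidableEq ι] (p : ι → unitInterval) (j : ι) (r : unitInterval) :
    ((bernoulliMeasure true false r).prod (bernoulliProduct p)).map
      (fun z => Function.update z.2 j z.1) = bernoulliProduct (Function.update p j r) := by
  have hm := measurable_update_prod j
  refine Measure.eq_infinitePi _ fun s t ht => ?_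
  rw [Measure.map_apply hm (MeasurableSet.pi s.countable_toSet fun i _ => ht i)]
  by_cases hj : j ∈ s
  · have : (fun z : Bool × (ι → Bool) => Function.update z.2 j z.1) ⁻¹' (Set.pi s t) =
        t j ×ˢ Set.pi (s.erase j : Finset ι) t := by
      ext z
      simp only [Set.mem_preimage, Set.mem_pi, Set.mem_prod, Finset.mem_coe, Finset.mem_erase]
      constructor
      · intro h
        exact ⟨by simpa using h j hj, fun i hi => by simpa [hi.1] using h i hi.2⟩
      · rintro ⟨h1, h2⟩ i hi
        by_cases h : i = j
        · subst h; simpa using h1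
        · simpa [h] using h2 i ⟨h, hi⟩
    rw [this, Measure.prod_prod, bernoulliProduct, Measure.infinitePi_pi _ (fun i _ => ht i),
      ← Finset.mul_prod_erase s _ hj]
    simp only [Function.update_self]
    congr 1
    refine Finset.prod_congr rfl fun i hi => ?_
    rw [Function.update_of_ne (Finset.ne_of_mem_erase hi)]
  · have : (fun z : Bool × (ι → Bool) => Function.update z.2 j z.1) ⁻¹' (Set.pi s t) =
        Set.univ ×ˢ Set.pi s t := by
      ext z
      simp only [Set.mem_preimage, Set.mem_pi, Set.mem_prod, Finset.mem_coe, Set.mem_univ,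
        true_and]
      refine forall₂_congr fun i hi => ?_
      have h : i ≠ j := by rintro rfl; exact hj hi
      simp [h]
    rw [this, Measure.prod_prod, bernoulliProduct, Measure.infinitePi_pi _ (fun i _ => ht i)]
    simp only [measure_univ, one_mul]
    refine Finset.prod_congr rfl fun i hi => ?_
    rw [Function.update_of_ne (by rintro rfl; exact hj hi)]

theorem measurable_update_const {ι : Type*} [DecidableEq ι] (j : ι) (b : Bool) :
    Measurable fun x : ι → Bool => Function.update x j b := by
  refine measurable_pi_lambda _ fun i => ?_
  by_cases h : i = j
  · subst h; simp
  · simpa [Function.update_of_ne h] using measurable_pi_apply i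

theorem prod_bernoulliMeasure_real {X : Type*} [MeasurableSpace X] (ν : Measure X)
    [IsProbabilityMeasure ν] (r : unitInterval) {A : Set (Bool × X)} (hA : MeasurableSet A) :
    ((bernoulliMeasure true false r).prod ν).real A =
      r * ν.real {x | (true, x) ∈ A} + (1 - r) * ν.real {x | (false, x) ∈ A} := by
  rw [measureReal_def, Measure.prod_apply hA, bernoulliMeasure_def, lintegral_add_measure]
  erw [lintegral_smul_measure, lintegral_smul_measure]
  rw [lintegral_dirac, lintegral_dirac]
  rw [ENNReal.toReal_add (by exact ENNReal.mul_ne_top ENNReal.coe_ne_top (measure_ne_top _ _))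
    (by exact ENNReal.mul_ne_top ENNReal.coe_ne_top (measure_ne_top _ _))]
  erw [ENNReal.toReal_mul, ENNReal.toReal_mul]
  rfl

/-- Conditioning on coordinate `j`. As `r` need not be `p j`, the same conditional probabilities
serve for both measures that are to be compared. -/
theorem bernoulliProduct_update_real {ι : Type*} [DecidableEq ι] (p : ι → unitInterval) (j : ι) (r : unitInterval)
    {B : Set (ι → Bool)} (hB : MeasurableSet B) :
    (bernoulliProduct (Function.update p j r)).real B =
      r * (bernoulliProduct p).real {x | Function.update x j true ∈ B} +
      (1 - r) * (bernoulliProduct p).real {x | Function.update x j false ∈ B} := by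
  have hm := measurable_update_prod j
  rw [← bernoulliProduct_update, map_measureReal_apply hm hB,
    prod_bernoulliMeasure_real _ _ (hm hB)]
  rfl

/-! ### Domination of a percolation with additional open pairs -/

/-- Open both elements of the pair `e`. -/
noncomputable def openPair {ι : Type*} (e : Sym2 ι) (x : ι → Bool) : ι → Bool :=
  open Classical in fun i => x i || decide (i ∈ e)

theorem openPair_mono {ι : Type*} (e : Sym2 ι) : Monotone (openPair e) := by
  intro x y h i
  have := h i
  simp only [openPair]
  revert this
  cases x i <;> cases y i <;> simp

theorem measurable_openPair {ι : Type*} (e : Sym2 ι) : Measurable (openPair e) := by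
  refine measurable_pi_lambda _ fun i => ?_
  exact (measurable_of_countable fun b : Bool => b || _).comp (measurable_pi_apply i)

open Classical in
theorem openPair_eq_update {ι : Type*} (j k : ι) (x : ι → Bool) :
    openPair s(j, k) x = Function.update (Function.update x j true) k true := by
  funext i
  by_cases h : i = k
  · simp [openPair, h]
  · by_cases h' : i = j
    · subst h'; simp [openPair, h]
    · simp [openPair, h, h']

/-- The `a`s are the probabilities of an increasing event given the states of the two elements.
After ordering `a01` and `a10`, it suffices to compare the increasing events of two bits: first
open, second open, both open, at least one open. The case of both open forces the constant: since
`p1, p2 ≥ c`, raising each by `r / c` adds at least `2 * r` to the product. Without a lower bound on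
the densities an increase linear in `r` would not suffice. -/
theorem pair_open_inequality {a00 a01 a10 a11 r c p1 p2 q1 q2 : ℝ} (h1 : a00 ≤ a01) (h2 : a00 ≤ a10)
    (h3 : a01 ≤ a11) (h4 : a10 ≤ a11) (hr0 : 0 ≤ r) (hr1 : r ≤ 1) (hc : 0 < c) (hc1 : c ≤ 1)
    (hp1 : c ≤ p1) (hp2 : c ≤ p2) (hp1' : p1 ≤ 1) (hp2' : p2 ≤ 1) (hq1' : q1 ≤ 1) (hq2' : q2 ≤ 1)
    (hq1 : q1 = 1 ∨ p1 + r / c ≤ q1) (hq2 : q2 = 1 ∨ p2 + r / c ≤ q2) :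
    (1 - r) * (p2 * (p1 * a11 + (1 - p1) * a01) + (1 - p2) * (p1 * a10 + (1 - p1) * a00)) + r * a11
      ≤ q2 * (q1 * a11 + (1 - q1) * a01) + (1 - q2) * (q1 * a10 + (1 - q1) * a00) := by
  have hrc : r ≤ r / c := by
    rw [le_div_iff₀ hc]; nlinarith
  have hrc' : r / c * c = r := div_mul_cancel₀ _ hc.ne'
  have i1 : (1 - r) * p1 + r ≤ q1 := by
    rcases hq1 with h | h <;> nlinarith
  have i2 : (1 - r) * p2 + r ≤ q2 := by
    rcases hq2 with h | h <;> nlinarith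
  have i3 : (1 - r) * (p1 * p2) + r ≤ q1 * q2 := by
    rcases hq1 with h | h
    · subst h; nlinarith [mul_nonneg (sub_nonneg.2 hr1) (mul_nonneg (sub_nonneg.2 hp1') (hc.le.trans hp2))]
    rcases hq2 with h' | h'
    · subst h'; nlinarith [mul_nonneg (sub_nonneg.2 hr1) (mul_nonneg (sub_nonneg.2 hp2') (hc.le.trans hp1))]
    have hx : 0 ≤ r / c := by positivity
    have : (p1 + r / c) * (p2 + r / c) ≤ q1 * q2 :=
      mul_le_mul h h' (by linarith) (by linarith)
    nlinarith [mul_le_mul_of_nonneg_left hp1 hx, mul_le_mul_of_nonneg_left hp2 hx,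
      mul_nonneg hr0 (mul_nonneg (hc.le.trans hp1) (hc.le.trans hp2)), mul_nonneg hx hx]
  have i4 : (1 - q1) * (1 - q2) ≤ (1 - r) * ((1 - p1) * (1 - p2)) := by
    have e1 : 1 - q1 ≤ (1 - r) * (1 - p1) := by linarith
    have e2 : 1 - q2 ≤ 1 - p2 := by nlinarith
    calc (1 - q1) * (1 - q2) ≤ ((1 - r) * (1 - p1)) * (1 - p2) :=
          mul_le_mul e1 e2 (by linarith) (mul_nonneg (by linarith) (by linarith))
      _ = _ := by ring
  rcases le_total a10 a01 with h | h
  · nlinarith [mul_nonneg (sub_nonneg.2 h2) (sub_nonneg.2 i4),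
      mul_nonneg (sub_nonneg.2 h) (sub_nonneg.2 i2), mul_nonneg (sub_nonneg.2 h3) (sub_nonneg.2 i3)]
  · nlinarith [mul_nonneg (sub_nonneg.2 h1) (sub_nonneg.2 i4),
      mul_nonneg (sub_nonneg.2 h) (sub_nonneg.2 i1), mul_nonneg (sub_nonneg.2 h4) (sub_nonneg.2 i3)]

theorem bernoulliProduct_real_mono {ι : Type*} {p q : ι → unitInterval} (hpq : p ≤ q)
    {B : Set (ι → Bool)} (hB : MeasurableSet B) (hup : IsUpperSet B) :
    (bernoulliProduct p).real B ≤ (bernoulliProduct q).real B :=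
  ENNReal.toReal_mono (measure_ne_top _ _) (bernoulliProduct_mono hpq hB hup)

theorem openPair_step {ι : Type*} {p q : ι → unitInterval} {c : ℝ} {r : unitInterval} {e : Sym2 ι}
    (hc : 0 < c) (hpc : ∀ i, c ≤ p i) (hpq : p ≤ q)
    (he : ∀ i ∈ e, (q i : ℝ) = 1 ∨ (p i : ℝ) + r / c ≤ q i)
    {B : Set (ι → Bool)} (hB : MeasurableSet B) (hup : IsUpperSet B) :
    (1 - r) * (bernoulliProduct p).real B + r * (bernoulliProduct p).real (openPair e ⁻¹' B) ≤
      (bernoulliProduct q).real B := by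
  classical
  induction e with | _ j k => ?_
  have hj := he j (Sym2.mem_mk_left j k)
  have hk := he k (Sym2.mem_mk_right j k)
  have hc1 : c ≤ 1 := (hpc j).trans (p j).2.2
  -- A diagonal pair has only one element, so the two-bit inequality is replaced by a one-bit one.
  by_cases hjk : j = k
  · subst hjk
    have hle : Function.update p j (q j) ≤ q := by
      intro i
      by_cases h : i = j
      · subst h; simp
      · simpa [h] using hpq i
    refine le_trans ?_ (bernoulliProduct_real_mono hle hB hup)
    have e1 := bernoulliProduct_update_real p j (p j) hB
    rw [Function.update_eq_self] at e1
    rw [e1, bernoulliProduct_update_real p j _ hB]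
    have e2 : openPair s(j, j) ⁻¹' B = {x | Function.update x j true ∈ B} := by
      ext x; simp [openPair_eq_update]
    rw [e2]
    have hle : (bernoulliProduct p).real {x | Function.update x j false ∈ B} ≤
        (bernoulliProduct p).real {x | Function.update x j true ∈ B} := by
      refine measureReal_mono fun x hx => hup ?_ hx
      exact update_le_update_iff.2 ⟨by simp, fun _ _ => le_rfl⟩
    have hrc : (r : ℝ) ≤ r / c := by
      rw [le_div_iff₀ hc]; nlinarith [r.2.1]
    have hq : (1 - (r : ℝ)) * p j + r ≤ q j := by
      rcases hj with h | h
      · nlinarith [(p j).2.2, r.2.2]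
      · nlinarith [(p j).2.1, r.2.1]
    nlinarith [mul_nonneg (sub_nonneg.2 hle) (sub_nonneg.2 hq)]
  · have hle : Function.update (Function.update p j (q j)) k (q k) ≤ q := by
      intro i
      by_cases h : i = k
      · subst h; simp
      by_cases h' : i = j
      · subst h'; simp [h]
      · simpa [h, h'] using hpq i
    refine le_trans ?_ (bernoulliProduct_real_mono hle hB hup)
    have main : ∀ s t : unitInterval,
        (bernoulliProduct (Function.update (Function.update p j s) k t)).real B =
        t * (s * (bernoulliProduct p).real
            {x | Function.update (Function.update x j true) k true ∈ B} +
          (1 - s) * (bernoulliProduct p).real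
            {x | Function.update (Function.update x j false) k true ∈ B}) +
        (1 - t) * (s * (bernoulliProduct p).real
            {x | Function.update (Function.update x j true) k false ∈ B} +
          (1 - s) * (bernoulliProduct p).real
            {x | Function.update (Function.update x j false) k false ∈ B}) := by
      intro s t
      have h1 := bernoulliProduct_update_real p j s (measurable_update_const k true hB)
      have h2 := bernoulliProduct_update_real p j s (measurable_update_const k false hB)
      rw [bernoulliProduct_update_real _ k t hB]
      exact congrArg₂ (· + ·) (congrArg _ h1) (congrArg _ h2)
    have e1 := main (p j) (p k)
    rw [Function.update_eq_self, Function.update_eq_self] at e1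
    have e2 : openPair s(j, k) ⁻¹' B =
        {x | Function.update (Function.update x j true) k true ∈ B} := by
      ext x; simp [openPair_eq_update]
    rw [e1, e2, main]
    have hmono : ∀ b b' d d' : Bool, b ≤ b' → d ≤ d' → (bernoulliProduct p).real
        {x | Function.update (Function.update x j b) k d ∈ B} ≤ (bernoulliProduct p).real
        {x | Function.update (Function.update x j b') k d' ∈ B} := by
      intro b b' d d' hb hd
      refine measureReal_mono fun x hx => hup ?_ hx
      refine update_le_update_iff.2 ⟨hd, fun i _ => ?_⟩
      exact update_le_update_iff.2 ⟨hb, fun _ _ => le_rfl⟩ i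
    exact pair_open_inequality (hmono _ _ _ _ (by simp) (by simp)) (hmono _ _ _ _ (by simp) (by simp))
      (hmono _ _ _ _ (by simp) (by simp)) (hmono _ _ _ _ (by simp) (by simp)) r.2.1 r.2.2 hc hc1
      (hpc j) (hpc k) (p j).2.2 (p k).2.2 (q j).2.2 (q k).2.2 hj hk

/-- Open both elements of every pair `e` of `E` with `b e = true`. -/
noncomputable def openPairs {ι : Type*} (E : Set (Sym2 ι)) (b : Sym2 ι → Bool) (x : ι → Bool) :
    ι → Bool :=
  open Classical in fun i => x i || decide (∃ e ∈ E, b e = true ∧ i ∈ e)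

theorem openPairs_empty {ι : Type*} (b : Sym2 ι → Bool) (x : ι → Bool) : openPairs ∅ b x = x := by
  funext i; simp [openPairs]

theorem openPairs_mono {ι : Type*} {E F : Set (Sym2 ι)} (h : E ⊆ F) (b : Sym2 ι → Bool)
    {x y : ι → Bool} (hxy : x ≤ y) : openPairs E b x ≤ openPairs F b y := by
  intro i
  have h1 := hxy i
  simp only [openPairs, Bool.le_iff_imp, Bool.or_eq_true, decide_eq_true_eq] at h1 ⊢
  rintro (h2 | ⟨e, he, h2⟩)
  · exact Or.inl (h1 h2)
  · exact Or.inr ⟨e, h he, h2⟩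

theorem measurable_openPairs {ι : Type*} [Countable ι] (E : Set (Sym2 ι)) :
    Measurable fun z : (ι → Bool) × (Sym2 ι → Bool) => openPairs E z.2 z.1 := by
  classical
  refine measurable_pi_lambda _ fun i => ?_
  have h : Measurable fun z : (ι → Bool) × (Sym2 ι → Bool) =>
      decide (∃ e ∈ E, z.2 e = true ∧ i ∈ e) := by
    refine measurable_decide_of_measurableSet ?_
    simp only [Set.ofPred_exists, Set.ofPred_and]
    refine MeasurableSet.iUnion fun e => (MeasurableSet.const _).inter
      (MeasurableSet.inter ?_ (MeasurableSet.const _))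
    have : Measurable fun z : (ι → Bool) × (Sym2 ι → Bool) => z.2 e := by fun_prop
    exact this (measurableSet_singleton true)
  have h' : Measurable fun z : (ι → Bool) × (Sym2 ι → Bool) => z.1 i := by fun_prop
  exact (measurable_of_countable fun b : Bool × Bool => b.1 || b.2).comp (h'.prodMk h)

open Classical in
theorem openPairs_insert_update {ι : Type*} {E : Finset (Sym2 ι)} {e : Sym2 ι} (he : e ∉ E)
    (b : Sym2 ι → Bool) (v : Bool) (x : ι → Bool) :
    openPairs (insert e E : Finset (Sym2 ι)) (Function.update b e v) x =
      if v then openPair e (openPairs E b x) else openPairs E b x := by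
  funext i
  have key : (∃ e' ∈ ((insert e E : Finset (Sym2 ι)) : Set (Sym2 ι)),
      Function.update b e v e' = true ∧ i ∈ e') ↔
      (v = true ∧ i ∈ e) ∨ ∃ e' ∈ (E : Set (Sym2 ι)), b e' = true ∧ i ∈ e' := by
    simp only [Finset.coe_insert, Set.mem_insert_iff, Finset.mem_coe, exists_eq_or_imp,
      Function.update_self]
    refine or_congr Iff.rfl (exists_congr fun e' => and_congr_right fun h => ?_)
    rw [Function.update_of_ne (by rintro rfl; exact he h)]
  simp only [openPairs, key]
  cases v
  · simp [openPairs]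
  · simp only [openPair, if_true]
    by_cases h : i ∈ e <;> simp [h, openPairs]

/-- The total rate added to `i` by the pairs of `E`. -/
noncomputable def addedDensity {ι : Type*} (c : ℝ) (r : Sym2 ι → unitInterval)
    (E : Finset (Sym2 ι)) (i : ι) : unitInterval :=
  open Classical in
  Set.projIcc 0 1 zero_le_one (c + (∑ e ∈ E with i ∈ e, (r e : ℝ)) / c)

/-- Induction on the set of pairs. Conditioning on the bit of a new pair `e` gives a mixture of the
events `B` and `openPair e ⁻¹' B` for the old pairs. Both are increasing, so the induction
hypothesis moves both to the same product measure, where `openPair_step` absorbs `e`. -/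
theorem openPairs_finset_le {ι : Type*} [Countable ι] {c : ℝ} (hc : 0 < c) (hc1 : c ≤ 1)
    (r : Sym2 ι → unitInterval) (E : Finset (Sym2 ι))
    {B : Set (ι → Bool)} (hB : MeasurableSet B) (hup : IsUpperSet B) :
    ((bernoulliProduct fun _ : ι => (⟨c, hc.le, hc1⟩ : unitInterval)).prod
      (bernoulliProduct r)).real {z | openPairs E z.2 z.1 ∈ B} ≤
      (bernoulliProduct (addedDensity c r E)).real B := by
  classical
  induction E using Finset.induction_on generalizing B with
  | empty =>
    have e1 : {z : (ι → Bool) × (Sym2 ι → Bool) |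
        openPairs ((∅ : Finset (Sym2 ι)) : Set (Sym2 ι)) z.2 z.1 ∈ B} = B ×ˢ Set.univ := by
      ext z; simp [openPairs_empty]
    rw [e1, measureReal_def, Measure.prod_prod]
    simp only [measure_univ, mul_one]
    refine le_of_eq ?_
    rw [measureReal_def]
    congr 3
    funext i
    apply Subtype.ext
    simp [addedDensity, Set.coe_projIcc, hc.le, hc1]
  | insert e E he ih =>
    set P := bernoulliProduct fun _ : ι => (⟨c, hc.le, hc1⟩ : unitInterval)
    have hA : MeasurableSet {z : (ι → Bool) × (Sym2 ι → Bool) |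
        openPairs ((insert e E : Finset (Sym2 ι)) : Set (Sym2 ι)) z.2 z.1 ∈ B} :=
      measurable_openPairs _ hB
    have h1 : (P.prod (bernoulliProduct r)).real {z | openPairs
        ((insert e E : Finset (Sym2 ι)) : Set (Sym2 ι)) z.2 z.1 ∈ B} =
        r e * (P.prod (bernoulliProduct r)).real
          {z | openPairs E z.2 z.1 ∈ openPair e ⁻¹' B} +
        (1 - r e) * (P.prod (bernoulliProduct r)).real {z | openPairs E z.2 z.1 ∈ B} := by
      -- Resampling the bit of `e` from a fresh Bernoulli variable leaves the law unchanged and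
      -- makes the conditioning explicit.
      let g : Bool × ((ι → Bool) × (Sym2 ι → Bool)) → (ι → Bool) × (Sym2 ι → Bool) :=
        fun z => (z.2.1, Function.update z.2.2 e z.1)
      have hg : Measurable g := by
        refine (measurable_fst.comp measurable_snd).prodMk ?_
        exact (measurable_update_prod e).comp
          (measurable_fst.prodMk (measurable_snd.comp measurable_snd))
      have hmap : ((bernoulliMeasure true false (r e)).prod (P.prod (bernoulliProduct r))).map g =
          P.prod (bernoulliProduct r) := by
        symm
        refine Measure.prod_eq fun s t hs ht => ?_
        rw [Measure.map_apply hg (hs.prod ht)]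
        have h2 := bernoulliProduct_update_real r e (r e) ht
        rw [Function.update_eq_self] at h2
        have h3 : ((bernoulliMeasure true false (r e)).prod (P.prod (bernoulliProduct r))).real
            (g ⁻¹' (s ×ˢ t)) = P.real s * (bernoulliProduct r).real t := by
          rw [prod_bernoulliMeasure_real _ _ (hg (hs.prod ht)), h2]
          have h4 : ∀ v : Bool, {x | (v, x) ∈ g ⁻¹' (s ×ˢ t)} =
              s ×ˢ {b | Function.update b e v ∈ t} := by
            intro v; ext x; rfl
          simp only [h4, measureReal_prod_prod]
          ring
        rw [← ENNReal.toReal_eq_toReal_iff' (measure_ne_top _ _)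
          (ENNReal.mul_ne_top (measure_ne_top _ _) (measure_ne_top _ _)), ENNReal.toReal_mul]
        exact h3
      rw [← hmap, map_measureReal_apply hg hA, prod_bernoulliMeasure_real _ _ (hg hA)]
      simp only [hmap]
      congr 2
      · congr 1
        ext z
        change openPairs ((insert e E : Finset (Sym2 ι)) : Set (Sym2 ι)) (Function.update z.2 e true)
          z.1 ∈ B ↔ _
        rw [openPairs_insert_update he]
        rfl
      · congr 1
        ext z
        change openPairs ((insert e E : Finset (Sym2 ι)) : Set (Sym2 ι)) (Function.update z.2 e false)
          z.1 ∈ B ↔ _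
        rw [openPairs_insert_update he]
        rfl
    rw [h1]
    have hB' := measurable_openPair e hB
    have hup' : IsUpperSet (openPair e ⁻¹' B) := hup.preimage (openPair_mono e)
    have h2 := ih hB hup
    have h3 := ih hB' hup'
    refine le_trans ?_ (openPair_step (p := addedDensity c r E) (c := c) (r := r e) (e := e) hc ?_ ?_ ?_
      hB hup)
    · nlinarith [(r e).2.1, (r e).2.2]
    · intro i
      have h4 : 0 ≤ (∑ e ∈ E with i ∈ e, (r e : ℝ)) / c :=
        div_nonneg (Finset.sum_nonneg fun e _ => (r e).2.1) hc.le
      simp [addedDensity, Set.coe_projIcc, hc1, h4]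
    · intro i
      refine Set.monotone_projIcc _ ?_
      gcongr
      · exact fun e _ _ => (r e).2.1
      · exact Finset.subset_insert e E
    · intro i hi
      have h5 : ∑ e' ∈ insert e E with i ∈ e', (r e' : ℝ) =
          r e + ∑ e' ∈ E with i ∈ e', (r e' : ℝ) := by
        rw [Finset.filter_insert, if_pos hi, Finset.sum_insert (by simp [he])]
      have h4 : 0 ≤ (∑ e ∈ E with i ∈ e, (r e : ℝ)) / c :=
        div_nonneg (Finset.sum_nonneg fun e _ => (r e).2.1) hc.le
      have h6 : 0 ≤ (r e : ℝ) / c := div_nonneg (r e).2.1 hc.le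
      simp only [addedDensity, Set.coe_projIcc, h5, add_div]
      -- Either the new density is clipped at 1, or neither density is clipped: the two alternatives
      -- allowed by `openPair_step`.
      rcases le_total 1 (c + ((r e : ℝ) / c + (∑ e ∈ E with i ∈ e, (r e : ℝ)) / c)) with h | h
      · left
        rw [min_eq_left h]; simp
      · right
        rw [min_eq_right h, min_eq_right (by linarith), max_eq_right (by linarith),
          max_eq_right (by linarith)]
        linarith

/-- Percolation of parameter `c` in which moreover independent pairs are opened, such that the
expected number of opened pairs at every `i` is at most `δ`, is dominated by percolation of
parameter `c + δ / c`. -/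
theorem openPairs_univ_le {ι : Type*} [Countable ι] {c p q : unitInterval} {δ : ℝ} (hc : 0 < (c : ℝ))
    (hpc : p ≤ c) {r : Sym2 ι → unitInterval} (hr : ∀ (E : Finset (Sym2 ι)) (i : ι),
      (∀ e ∈ E, i ∈ e) → ∑ e ∈ E, (r e : ℝ) ≤ δ) (hq : (c : ℝ) + δ / c ≤ q)
    {B : Set (ι → Bool)} (hB : IsOpen B) (hup : IsUpperSet B) :
    ((percMeasure ι p).prod (bernoulliProduct r)) {z | openPairs Set.univ z.2 z.1 ∈ B} ≤
      percMeasure ι q B := by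
  classical
  have hBm := hB.measurableSet
  have hdir : Directed (· ⊆ ·) fun E : Finset (Sym2 ι) =>
      {z : (ι → Bool) × (Sym2 ι → Bool) | openPairs (E : Set (Sym2 ι)) z.2 z.1 ∈ B} := by
    refine Monotone.directed_le fun E F hEF z hz => ?_
    exact hup (openPairs_mono (Finset.coe_subset.2 hEF) _ le_rfl) hz
  -- The configurations obtained from finite sets of pairs converge pointwise to the full one, and
  -- `B` is open, so some finite set already suffices.
  have hsub : {z : (ι → Bool) × (Sym2 ι → Bool) | openPairs Set.univ z.2 z.1 ∈ B} ⊆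
      ⋃ E : Finset (Sym2 ι), {z | openPairs (E : Set (Sym2 ι)) z.2 z.1 ∈ B} := by
    intro z hz
    have hlim : Filter.Tendsto (fun E : Finset (Sym2 ι) => openPairs (E : Set (Sym2 ι)) z.2 z.1)
        Filter.atTop (nhds (openPairs Set.univ z.2 z.1)) := by
      rw [tendsto_pi_nhds]
      intro i
      refine tendsto_nhds_of_eventually_eq ?_
      by_cases h : ∃ e ∈ (Set.univ : Set (Sym2 ι)), z.2 e = true ∧ i ∈ e
      · obtain ⟨e, -, he⟩ := h
        filter_upwards [Filter.eventually_ge_atTop {e}] with E hE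
        have h1 : ∃ e ∈ (Set.univ : Set (Sym2 ι)), z.2 e = true ∧ i ∈ e := ⟨e, trivial, he⟩
        have h2 : ∃ e ∈ (E : Set (Sym2 ι)), z.2 e = true ∧ i ∈ e :=
          ⟨e, by simpa using hE, he⟩
        simp only [openPairs, h1, h2]
      · refine Filter.Eventually.of_forall fun E => ?_
        have h2 : ¬ ∃ e ∈ (E : Set (Sym2 ι)), z.2 e = true ∧ i ∈ e :=
          fun ⟨e, _, he⟩ => h ⟨e, trivial, he⟩
        simp only [openPairs, h, h2]
    obtain ⟨E, hE⟩ := (hlim.eventually (hB.mem_nhds hz)).exists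
    exact Set.mem_iUnion.2 ⟨E, hE⟩
  refine (measure_mono hsub).trans ?_
  rw [hdir.measure_iUnion]
  refine iSup_le fun E => ?_
  have hmeas : MeasurableSet {z : (ι → Bool) × (Sym2 ι → Bool) |
      openPairs (E : Set (Sym2 ι)) z.2 z.1 ∈ B} := measurable_openPairs _ hBm
  -- The density `p` may vanish; it is first raised to `c`, which provides the positive lower bound.
  have h1 : ((percMeasure ι p).prod (bernoulliProduct r))
      {z | openPairs (E : Set (Sym2 ι)) z.2 z.1 ∈ B} ≤
      ((percMeasure ι c).prod (bernoulliProduct r))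
      {z | openPairs (E : Set (Sym2 ι)) z.2 z.1 ∈ B} := by
    rw [Measure.prod_apply_symm hmeas, Measure.prod_apply_symm hmeas]
    refine lintegral_mono fun b => ?_
    refine bernoulliProduct_mono (fun _ => hpc) (measurable_prodMk_right hmeas) ?_
    intro x y hxy hx
    exact hup (openPairs_mono le_rfl _ hxy) hx
  refine h1.trans ?_
  have h2 : ((percMeasure ι c).prod (bernoulliProduct r))
      {z | openPairs (E : Set (Sym2 ι)) z.2 z.1 ∈ B} ≤ bernoulliProduct (addedDensity c r E) B :=
    (ENNReal.toReal_le_toReal (measure_ne_top _ _) (measure_ne_top _ _)).1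
      (openPairs_finset_le hc c.2.2 r E hBm hup)
  refine h2.trans (bernoulliProduct_mono (fun i => ?_) hBm hup)
  rw [← Subtype.coe_le_coe]
  have h3 := hr (E.filter fun e => i ∈ e) i (by simp)
  have h4 : (∑ e ∈ E with i ∈ e, (r e : ℝ)) / c ≤ δ / c := div_le_div_of_nonneg_right h3 hc.le
  simp only [addedDensity, Set.coe_projIcc]
  exact max_le q.2.1 ((min_le_right _ _).trans (by linarith))

/-! ### Percolation events -/

/-- The properties of the event of percolation used below: it is a countable increasing union of
countable decreasing intersections of increasing clopen events, and it is not affected by the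
modification of finitely many coordinates. -/
structure IsPercolationEvent {ι : Type*} (Inf : (ι → Bool) → Prop) : Prop where
  exists_clopen : ∃ B : ℕ → ℕ → Set (ι → Bool), (∀ m n, IsClopen (B m n)) ∧
    (∀ m n, IsUpperSet (B m n)) ∧ (∀ n, Monotone fun m => B m n) ∧ (∀ m, Antitone (B m)) ∧
    ∀ η, Inf η ↔ ∃ m, ∀ n, η ∈ B m n
  finite_modification : ∀ η η' : ι → Bool, {i | η i ≠ η' i}.Finite → Inf η → Inf η'

namespace IsPercolationEvent

variable {ι : Type*} {Inf : (ι → Bool) → Prop}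

theorem isUpperSet (h : IsPercolationEvent Inf) : IsUpperSet {η | Inf η} := by
  obtain ⟨B, -, hup, -, -, hB⟩ := h.exists_clopen
  intro η η' hle hη
  obtain ⟨m, hm⟩ := (hB η).1 hη
  exact (hB η').2 ⟨m, fun n => hup m n hle (hm n)⟩

theorem measurableSet [Countable ι] (h : IsPercolationEvent Inf) : MeasurableSet {η | Inf η} := by
  obtain ⟨B, hcl, -, -, -, hB⟩ := h.exists_clopen
  have : {η | Inf η} = ⋃ m, ⋂ n, B m n := by
    ext η; simp [hB]
  rw [this]
  exact MeasurableSet.iUnion fun m => MeasurableSet.iInter fun n => (hcl m n).isOpen.measurableSet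

/-- To compare the probabilities of percolation under two measures, it suffices to compare the
probabilities of increasing clopen events. -/
theorem measure_le [Countable ι] (h : IsPercolationEvent Inf) {μ ν : Measure (ι → Bool)}
    [IsFiniteMeasure μ] [IsFiniteMeasure ν]
    (hle : ∀ B : Set (ι → Bool), IsClopen B → IsUpperSet B → μ B ≤ ν B) :
    μ {η | Inf η} ≤ ν {η | Inf η} := by
  obtain ⟨B, hcl, hup, hmono, hanti, hB⟩ := h.exists_clopen
  have h1 : {η | Inf η} = ⋃ m, ⋂ n, B m n := by
    ext η; simp [hB]
  have h2 : Directed (· ⊆ ·) fun m => ⋂ n, B m n :=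
    Monotone.directed_le fun m m' hm => Set.iInter_mono fun n => hmono n hm
  rw [h1, h2.measure_iUnion, h2.measure_iUnion]
  refine iSup_mono fun m => ?_
  have hd : Directed (· ⊇ ·) (B m) := (hanti m).directed_ge
  have hn : ∀ n, NullMeasurableSet (B m n) μ :=
    fun n => (hcl m n).isOpen.measurableSet.nullMeasurableSet
  have hn' : ∀ n, NullMeasurableSet (B m n) ν :=
    fun n => (hcl m n).isOpen.measurableSet.nullMeasurableSet
  rw [hd.measure_iInter hn ⟨0, measure_ne_top _ _⟩, hd.measure_iInter hn' ⟨0, measure_ne_top _ _⟩]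
  exact iInf_mono fun n => hle _ (hcl m n) (hup m n)

/-- Zero-one law. -/
theorem bernoulliProduct_zero_or_one [Countable ι] (h : IsPercolationEvent Inf)
    (p : ι → unitInterval) :
    bernoulliProduct p {η | Inf η} = 0 ∨ bernoulliProduct p {η | Inf η} = 1 := by
  classical
  have hind : iIndep (fun i : ι => MeasurableSpace.comap (fun x : ι → Bool => x i) inferInstance)
      (bernoulliProduct p) :=
    (iIndepFun_infinitePi (P := fun i => bernoulliMeasure true false (p i)) (X := fun _ x => x)
      (fun i => measurable_id)).iIndep
  refine measure_zero_or_one_of_measurableSet_limsup (p := Set.Finite) (f := Filter.cofinite)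
    (ns := fun E : Finset ι => (E : Set ι))
    (fun i => (measurable_pi_apply i).comap_le) hind (fun t ht => ht.compl_mem_cofinite)
    (Monotone.directed_le fun E F hEF => Finset.coe_subset.2 hEF)
    (fun E => E.finite_toSet) (fun i => ⟨{i}, by simp⟩) ?_
  rw [Filter.HasBasis.limsup_eq_iInf_iSup Filter.hasBasis_cofinite]
  simp only [MeasurableSpace.measurableSet_iInf]
  intro t ht
  -- Closing all coordinates of the finite set `t` does not affect the event, which is therefore
  -- measurable with respect to the coordinates outside `t`.
  let φ : (ι → Bool) → ι → Bool := fun x i => if i ∈ t then false else x i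
  have hφ : {η | Inf η} = φ ⁻¹' {η | Inf η} := by
    ext η
    have hfin : {i | η i ≠ φ η i}.Finite := ht.subset fun i hi => by
      by_contra hit
      exact hi (by simp [φ, hit])
    constructor
    · exact h.finite_modification _ _ hfin
    · refine h.finite_modification _ _ ?_
      simpa only [ne_comm] using hfin
  rw [hφ]
  refine MeasurableSet.preimage (m := _) h.measurableSet ?_
  refine @measurable_pi_lambda _ _ _ (_) _ _ fun i => ?_
  by_cases hi : i ∈ t
  · simp only [φ, hi, if_true]
    exact @measurable_const _ _ _ (_) _
  · simp only [φ, hi, if_false]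
    refine Measurable.mono (ma := MeasurableSpace.comap (fun x : ι → Bool => x i) inferInstance)
      (comap_measurable _) ?_ le_rfl
    exact le_iSup₂_of_le i hi le_rfl

end IsPercolationEvent

/-! ### Clusters of edges that are open as soon as finitely many coordinates are -/

/-- The graph `H η` consists of the edges of the locally finite graph `G` for which all coordinates
in the finite set `S u v` are open, and every coordinate occurs for finitely many edges only. -/
structure IsOpenGraph {V ι : Type*} (G : SimpleGraph V) (S : V → V → Set ι)
    (H : (ι → Bool) → SimpleGraph V) : Prop where
  adj_iff : ∀ η u v, (H η).Adj u v ↔ G.Adj u v ∧ ∀ i ∈ S u v, η i = true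
  neighbors_finite : ∀ v, (G.neighborSet v).Finite
  coords_finite : ∀ u v, (S u v).Finite
  edges_finite : ∀ i, {z : V × V | G.Adj z.1 z.2 ∧ i ∈ S z.1 z.2}.Finite

namespace IsOpenGraph

variable {V ι : Type*} {G : SimpleGraph V} {S : V → V → Set ι} {H : (ι → Bool) → SimpleGraph V}

theorem mono (h : IsOpenGraph G S H) : Monotone H := by
  intro η η' hle u v huv
  rw [h.adj_iff] at huv ⊢
  exact ⟨huv.1, fun i hi => by simpa [huv.2 i hi, Bool.le_iff_imp] using hle i⟩

theorem isClopen_adj (h : IsOpenGraph G S H) (u v : V) : IsClopen {η | (H η).Adj u v} := by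
  have : {η | (H η).Adj u v} = {_η | G.Adj u v} ∩ ⋂ i ∈ S u v, {η | η i = true} := by
    ext η; simp [h.adj_iff]
  rw [this]
  refine IsClopen.inter ?_ ((h.coords_finite u v).isClopen_biInter fun i _ => ?_)
  · by_cases h' : G.Adj u v
    · simp [h', isClopen_univ]
    · simp [h', isClopen_empty]
  · exact (isClopen_discrete {true}).preimage (continuous_apply i)

theorem eventually_reachable (h : IsOpenGraph G S H) {η : ι → Bool} {u v : V}
    (huv : (H η).Reachable u v) : ∀ᶠ η' in nhds η, (H η').Reachable u v := by
  obtain ⟨p⟩ := huv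
  induction p with
  | nil => exact Filter.Eventually.of_forall fun η' => SimpleGraph.Reachable.refl _
  | cons hadj p ih =>
    filter_upwards [ih, (h.isClopen_adj _ _).isOpen.mem_nhds hadj] with η' h1 h2
    exact SimpleGraph.Reachable.trans (SimpleGraph.Adj.reachable h2) h1

theorem isUpperSet_le_encard (h : IsOpenGraph G S H) (n : ℕ) (v : V) :
    IsUpperSet {η | (n : ℕ∞) ≤ {x | (H η).Reachable v x}.encard} := by
  intro η η' hle hη
  exact le_trans hη (Set.encard_le_encard fun x hx => hx.mono (h.mono hle))

/-- Open: `n` connections use finitely many coordinates. Closed: a cluster with fewer than `n`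
vertices has a finite edge boundary by local finiteness, and for nearby configurations these
boundary edges remain absent, so the cluster cannot grow. -/
theorem isClopen_le_encard (h : IsOpenGraph G S H) (n : ℕ) (v : V) :
    IsClopen {η | (n : ℕ∞) ≤ {x | (H η).Reachable v x}.encard} := by
  constructor
  · rw [← isOpen_compl_iff, isOpen_iff_eventually]
    intro η hη
    simp only [Set.mem_compl_iff, Set.mem_ofPred_eq, not_le] at hη ⊢
    set C := {x | (H η).Reachable v x} with hC
    have hCfin : C.Finite := Set.finite_of_encard_le_coe hη.le
    have h1 : ∀ᶠ η' in nhds η, ∀ x ∈ C, ∀ y ∈ G.neighborSet x, ¬ (H η).Adj x y →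
        ¬ (H η').Adj x y := by
      refine (Filter.eventually_all_finite hCfin).2 fun x _ =>
        (Filter.eventually_all_finite (h.neighbors_finite x)).2 fun y _ => ?_
      by_cases hxy : (H η).Adj x y
      · simp [hxy]
      · filter_upwards [(h.isClopen_adj x y).compl.isOpen.mem_nhds hxy] with η' h' _
        exact h'
    filter_upwards [h1] with η' h2
    refine lt_of_le_of_lt (Set.encard_le_encard fun x hx => ?_) hη
    obtain ⟨p⟩ := hx
    have key : ∀ {a b : V}, (H η').Walk a b → a ∈ C → b ∈ C := by
      intro a b p
      induction p with
      | nil => exact id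
      | @cons a b c hadj p ih =>
        intro ha
        refine ih ?_
        by_contra hb
        refine h2 a ha b ((h.adj_iff _ _ _).1 hadj).1 (fun hab => hb ?_) hadj
        exact SimpleGraph.Reachable.trans ha hab.reachable
    exact key p (SimpleGraph.Reachable.refl _)
  · rw [isOpen_iff_eventually]
    intro η hη
    obtain ⟨T, hT, hTn⟩ := Set.exists_subset_encard_eq hη
    have hTfin : T.Finite := Set.finite_of_encard_eq_coe hTn
    have : ∀ᶠ η' in nhds η, ∀ x ∈ T, (H η').Reachable v x :=
      (Filter.eventually_all_finite hTfin).2 fun x hx => h.eventually_reachable (hT hx)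
    filter_upwards [this] with η' h'
    exact hTn.symm.le.trans (Set.encard_le_encard h')

/-- Following the old cluster of `v`, each edge lost ends in one of finitely many vertices. The old
cluster is thus covered by the new clusters of finitely many vertices, and one of these must be
infinite. -/
theorem finite_modification (h : IsOpenGraph G S H) {η η' : ι → Bool}
    (hfin : {i | η i ≠ η' i}.Finite) {v : V} (hv : {x | (H η).Reachable v x}.Infinite) :
    ∃ u, {x | (H η').Reachable u x}.Infinite := by
  by_contra! hcon
  let T : Set V := {v} ∪ ⋃ i ∈ {i | η i ≠ η' i},
    Prod.snd '' {z : V × V | G.Adj z.1 z.2 ∧ i ∈ S z.1 z.2}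
  have hT : T.Finite := (Set.finite_singleton v).union
    (hfin.biUnion fun i _ => (h.edges_finite i).image _)
  refine hv ((hT.biUnion fun u _ => hcon u).subset
    (s := ⋃ u ∈ T, {x | (H η').Reachable u x}) ?_)
  intro x hx
  obtain ⟨p⟩ := hx
  have key : ∀ {a b : V}, (H η).Walk a b → (∃ u ∈ T, (H η').Reachable u a) →
      ∃ u ∈ T, (H η').Reachable u b := by
    intro a b p
    induction p with
    | nil => exact id
    | @cons a b c hadj p ih =>
      rintro ⟨u, hu, hua⟩
      refine ih ?_
      by_cases hab : (H η').Adj a b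
      · exact ⟨u, hu, hua.trans hab.reachable⟩
      · rw [h.adj_iff] at hadj hab
        have : ∃ i ∈ S a b, η' i ≠ true := by
          by_contra! hall
          exact hab ⟨hadj.1, hall⟩
        obtain ⟨i, hi, hi'⟩ := this
        refine ⟨b, Or.inr ?_, SimpleGraph.Reachable.refl _⟩
        refine Set.mem_biUnion (x := i) ?_ ⟨(a, b), ⟨hadj.1, hi⟩, rfl⟩
        change η i ≠ η' i
        rw [hadj.2 i hi]
        exact fun h => hi' h.symm
  obtain ⟨u, hu, hux⟩ := key p ⟨v, Or.inl rfl, SimpleGraph.Reachable.refl _⟩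
  exact Set.mem_biUnion hu hux

theorem isPercolationEvent [Countable V] (h : IsOpenGraph G S H) :
    IsPercolationEvent fun η => ∃ v, {x | (H η).Reachable v x}.Infinite := by
  refine ⟨?_, ?_⟩
  · have := Encodable.ofCountable V
    have hfin : ∀ m : ℕ, {v : V | Encodable.encode v ≤ m}.Finite := fun m =>
      (Set.finite_Iic m).preimage Encodable.encode_injective.injOn
    -- The event `B m n` says that one of the vertices of code at most `m` has a cluster of at least
    -- `n` vertices.
    refine ⟨fun m n => ⋃ v ∈ {v : V | Encodable.encode v ≤ m},
      {η | (n : ℕ∞) ≤ {x | (H η).Reachable v x}.encard}, ?_, ?_, ?_, ?_, ?_⟩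
    · exact fun m n => (hfin m).isClopen_biUnion fun v _ => h.isClopen_le_encard n v
    · exact fun m n => isUpperSet_iUnion₂ fun v _ => h.isUpperSet_le_encard n v
    · exact fun n m m' hm => Set.biUnion_mono (fun v hv => le_trans hv hm) fun _ _ => le_rfl
    · intro m n n' hn
      refine Set.iUnion₂_mono fun v _ η hη => ?_
      have h1 : (n : ℕ∞) ≤ n' := by exact_mod_cast hn
      exact le_trans h1 hη
    · intro η
      constructor
      · rintro ⟨v, hv⟩
        refine ⟨Encodable.encode v, fun n => Set.mem_biUnion (x := v) (le_refl (Encodable.encode v)) ?_⟩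
        change (n : ℕ∞) ≤ Set.encard _
        rw [hv.encard_eq]
        exact le_top
      · rintro ⟨m, hm⟩
        by_contra! hcon
        -- The vertex may depend on `n`; since only finitely many vertices compete, finite clusters
        -- would have a finite union, contradicting large `n`.
        have hU : (⋃ v ∈ {v : V | Encodable.encode v ≤ m}, {x | (H η).Reachable v x}).Finite :=
          (hfin m).biUnion fun v _ => hcon v
        obtain ⟨v, hv, hvn⟩ := Set.mem_iUnion₂.1 (hm (Set.ncard (⋃ v ∈ {v : V |
          Encodable.encode v ≤ m}, {x | (H η).Reachable v x}) + 1))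
        have h1 : {x | (H η).Reachable v x}.encard ≤ (⋃ v ∈ {v : V | Encodable.encode v ≤ m},
            {x | (H η).Reachable v x}).encard :=
          Set.encard_le_encard (Set.subset_biUnion_of_mem (u := fun v => {x | (H η).Reachable v x}) hv)
        rw [← hU.cast_ncard_eq] at h1
        have h2 := le_trans hvn h1
        norm_cast at h2
        omega
  · rintro η η' hfin ⟨v, hv⟩
    exact h.finite_modification hfin hv

end IsOpenGraph

/-! ### Bond and site percolation -/

theorem isOpenGraph_bond {V : Type*} {G : SimpleGraph V} (hfin : ∀ v, (G.neighborSet v).Finite) :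
    IsOpenGraph G (fun u v => {e : G.edgeSet | e.1 = s(u, v)}) (openBondGraph G) where
  adj_iff η u v := by
    simp only [openBondGraph, SimpleGraph.fromEdgeSet_adj, Set.mem_ofPred_eq,
      SimpleGraph.mem_edgeSet]
    constructor
    · rintro ⟨⟨h, hη⟩, -⟩
      refine ⟨h, ?_⟩
      rintro ⟨e, he⟩ rfl
      exact hη
    · rintro ⟨h, hη⟩
      exact ⟨⟨h, hη _ rfl⟩, h.ne⟩
  neighbors_finite := hfin
  coords_finite u v := Set.Subsingleton.finite fun e he e' he' => Subtype.ext (he.trans he'.symm)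
  edges_finite := by
    rintro ⟨e, he⟩
    induction e with | _ a b => ?_
    refine ((Set.finite_singleton (a, b)).union (Set.finite_singleton (b, a))).subset ?_
    rintro ⟨x, y⟩ ⟨-, h⟩
    have h' : s(a, b) = s(x, y) := h
    rw [Sym2.eq_iff] at h'
    rcases h' with ⟨rfl, rfl⟩ | ⟨rfl, rfl⟩ <;> simp

theorem isPercolationEvent_bond {V : Type*} [Countable V] {G : SimpleGraph V}
    (hfin : ∀ v, (G.neighborSet v).Finite) : IsPercolationEvent (HasInfiniteBondCluster G) := by
  have h : HasInfiniteBondCluster G =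
      fun η => ∃ v, {x | (openBondGraph G η).Reachable v x}.Infinite := by
    funext η
    refine propext ⟨?_, ?_⟩
    · rintro ⟨C, hC⟩
      induction C using SimpleGraph.ConnectedComponent.ind with | _ v => ?_
      refine ⟨v, hC.mono fun x hx => ?_⟩
      exact (SimpleGraph.ConnectedComponent.exact hx).symm
    · rintro ⟨v, hv⟩
      refine ⟨(openBondGraph G η).connectedComponentMk v, hv.mono fun x hx => ?_⟩
      exact SimpleGraph.ConnectedComponent.sound hx.symm
  rw [h]
  exact (isOpenGraph_bond hfin).isPercolationEvent

/-- The graph of edges of `G` between open vertices. -/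
def openSiteGraph {V : Type*} (G : SimpleGraph V) (η : V → Bool) : SimpleGraph V where
  Adj u v := G.Adj u v ∧ η u = true ∧ η v = true
  symm := ⟨fun _ _ h => ⟨h.1.symm, h.2.2, h.2.1⟩⟩
  loopless := ⟨fun _ h => h.1.ne rfl⟩

theorem isOpenGraph_site {V : Type*} {G : SimpleGraph V} (hfin : ∀ v, (G.neighborSet v).Finite) :
    IsOpenGraph G (fun u v => {u, v}) (openSiteGraph G) where
  adj_iff η u v := by simp [openSiteGraph]
  neighbors_finite := hfin
  coords_finite u v := by simp
  edges_finite i := by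
    refine ((((hfin i).image fun x => (i, x))).union ((hfin i).image fun x => (x, i))).subset ?_
    rintro ⟨x, y⟩ ⟨hxy, h⟩
    rcases h with rfl | h
    · exact Or.inl ⟨y, hxy, rfl⟩
    · obtain rfl : i = y := h
      exact Or.inr ⟨x, hxy.symm, rfl⟩

theorem isPercolationEvent_site {V : Type*} [Countable V] {G : SimpleGraph V}
    (hfin : ∀ v, (G.neighborSet v).Finite) : IsPercolationEvent (HasInfiniteSiteCluster G) := by
  have h : HasInfiniteSiteCluster G =
      fun η => ∃ v, {x | (openSiteGraph G η).Reachable v x}.Infinite := by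
    funext η
    refine propext ⟨?_, ?_⟩
    · rintro ⟨C, hC⟩
      induction C using SimpleGraph.ConnectedComponent.ind with | _ v => ?_
      refine ⟨v, (hC.image Subtype.val_injective.injOn).mono ?_⟩
      rintro _ ⟨x, hx, rfl⟩
      let f : G.induce {v | η v = true} →g openSiteGraph G η :=
        ⟨Subtype.val, fun {a b} hab => ⟨hab, a.2, b.2⟩⟩
      exact (SimpleGraph.ConnectedComponent.exact hx).symm.map f
    · rintro ⟨v, hv⟩
      -- Closed vertices are isolated in `openSiteGraph`, so every walk with at least one step lives
      -- in the induced graph.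
      have key : ∀ {a b : V}, (openSiteGraph G η).Walk a b → a = b ∨
          ∃ (ha : η a = true) (hb : η b = true),
            (G.induce {v | η v = true}).Reachable ⟨a, ha⟩ ⟨b, hb⟩ := by
        intro a b p
        induction p with
        | nil => exact Or.inl rfl
        | @cons a b c hadj p ih =>
          right
          have hab : (G.induce {v | η v = true}).Adj ⟨a, hadj.2.1⟩ ⟨b, hadj.2.2⟩ := hadj.1
          rcases ih with rfl | ⟨hb, hc, hbc⟩
          · exact ⟨hadj.2.1, hadj.2.2, hab.reachable⟩
          · exact ⟨hadj.2.1, hc, hab.reachable.trans hbc⟩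
      have hv' : η v = true := by
        by_contra hcon
        refine hv ((Set.finite_singleton v).subset ?_)
        rintro x ⟨p⟩
        rcases key p with h | ⟨h, -⟩
        · exact h.symm
        · exact absurd h hcon
      refine ⟨(G.induce {v | η v = true}).connectedComponentMk ⟨v, hv'⟩, fun hfin => ?_⟩
      refine hv ((hfin.image Subtype.val).subset ?_)
      rintro x ⟨p⟩
      rcases key p with rfl | ⟨_, hx, h⟩
      · exact ⟨⟨v, hv'⟩, rfl, rfl⟩
      · exact ⟨⟨x, hx⟩, SimpleGraph.ConnectedComponent.sound h.symm, rfl⟩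
  rw [h]
  exact (isOpenGraph_site hfin).isPercolationEvent

/-! ### Stability of both phases under sparse random openings or closings. -/

/-- The set of pairs at `i` that are opened has expected size at most `δ`. -/
def PairRateLe {ι : Type*} (r : Sym2 ι → unitInterval) (δ : ℝ) : Prop :=
  ∀ (E : Finset (Sym2 ι)) (i : ι), (∀ e ∈ E, i ∈ e) → ∑ e ∈ E, (r e : ℝ) ≤ δ

namespace IsPercolationEvent

variable {ι : Type*} {Inf : (ι → Bool) → Prop}

theorem exists_of_lt_criticalPoint {p : unitInterval}
    (hp : (p : ℝ) < criticalPoint Inf) :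
    ∃ q : unitInterval, p < q ∧ percMeasure ι q {η | Inf η} = 0 := by
  have hne : {q : ℝ | ∃ h : q ∈ unitInterval, percMeasure ι ⟨q, h⟩ {η | Inf η} = 0}.Nonempty := by
    by_contra hcon
    rw [Set.not_nonempty_iff_eq_empty] at hcon
    -- The supremum of the empty set of reals is 0, which cannot exceed `p`.
    rw [criticalPoint, hcon, Real.sSup_empty] at hp
    exact absurd p.2.1 (not_le.2 hp)
  obtain ⟨q, ⟨hq, hq0⟩, hpq⟩ := exists_lt_of_lt_csSup hne hp
  exact ⟨⟨q, hq⟩, hpq, hq0⟩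

variable [Countable ι]

theorem percMeasure_eq_one_of_criticalPoint_lt (h : IsPercolationEvent Inf) {q : unitInterval}
    (hq : criticalPoint Inf < q) : percMeasure ι q {η | Inf η} = 1 := by
  refine (h.bernoulliProduct_zero_or_one fun _ => q).resolve_left fun h0 => ?_
  have hbdd : BddAbove {q : ℝ | ∃ h : q ∈ unitInterval, percMeasure ι ⟨q, h⟩ {η | Inf η} = 0} :=
    ⟨1, fun x hx => hx.1.2⟩
  exact absurd (le_csSup hbdd ⟨q.2, h0⟩) (not_le.2 hq)

/-- Take `p < c < q` with no percolation at `q`. The choice `δ = c * (q - c)` makes the dominating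
density `c + δ / c` equal to `q`. -/
theorem exists_rate_of_lt_criticalPoint (h : IsPercolationEvent Inf) {p : unitInterval}
    (hp : (p : ℝ) < criticalPoint Inf) :
    percMeasure ι p {η | Inf η} = 0 ∧ ∃ δ > 0, ∀ r, PairRateLe r δ →
      ∀ᵐ z ∂(percMeasure ι p).prod (bernoulliProduct r),
        ¬ Inf (openPairs Set.univ z.2 z.1) := by
  obtain ⟨q, hpq, hq⟩ := exists_of_lt_criticalPoint hp
  have hp0 : percMeasure ι p {η | Inf η} = 0 :=
    le_antisymm ((bernoulliProduct_mono (fun _ => hpq.le) h.measurableSet h.isUpperSet).trans hq.le)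
      zero_le
  refine ⟨hp0, ?_⟩
  obtain ⟨c, hpc, hcq⟩ := exists_between hpq
  have hc : 0 < (c : ℝ) := lt_of_le_of_lt p.2.1 hpc
  have hcq' : (c : ℝ) < q := hcq
  refine ⟨c * (q - c), mul_pos hc (by linarith), fun r hr => ?_⟩
  have hm := measurable_openPairs (Set.univ : Set (Sym2 ι))
  have hprob : IsProbabilityMeasure (((percMeasure ι p).prod (bernoulliProduct r)).map
      fun z => openPairs Set.univ z.2 z.1) := Measure.isProbabilityMeasure_map hm.aemeasurable
  have hle := h.measure_le (μ := ((percMeasure ι p).prod (bernoulliProduct r)).map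
      fun z => openPairs Set.univ z.2 z.1) (ν := percMeasure ι q) fun B hB hup => by
    rw [Measure.map_apply hm hB.isOpen.measurableSet]
    refine openPairs_univ_le hc hpc.le hr ?_ hB.isOpen hup
    rw [mul_div_cancel_left₀ _ hc.ne']
    linarith
  rw [Measure.map_apply hm h.measurableSet, hq] at hle
  rw [ae_iff]
  simpa using hle

/-- The closed elements form a percolation of parameter `1 - p`, to which the same domination
applies, with `1 - c'` as base density and `1 - q'` as dominating density, where `q' < c' < p` and
`q'` is still supercritical. Complements of increasing events become increasing after the flip. -/
theorem exists_rate_of_criticalPoint_lt (h : IsPercolationEvent Inf) {p : unitInterval}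
    (hp : criticalPoint Inf < p) :
    percMeasure ι p {η | Inf η} = 1 ∧ ∃ δ > 0, ∀ r, PairRateLe r δ →
      ∀ᵐ z ∂(percMeasure ι p).prod (bernoulliProduct r),
        Inf fun i => !openPairs Set.univ z.2 (fun j => !z.1 j) i := by
  refine ⟨h.percMeasure_eq_one_of_criticalPoint_lt hp, ?_⟩
  have h0 : 0 ≤ criticalPoint Inf := Real.sSup_nonneg fun x hx => hx.1.1
  obtain ⟨q', hq, hqp⟩ := exists_between hp
  obtain ⟨c', hqc, hcp⟩ := exists_between hqp
  have hp1 := p.2.2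
  let q : unitInterval := ⟨q', by constructor <;> linarith⟩
  let c : unitInterval := ⟨c', by constructor <;> linarith⟩
  have hq1 : percMeasure ι q {η | Inf η} = 1 := h.percMeasure_eq_one_of_criticalPoint_lt hq
  have hc : 0 < ((unitInterval.symm c : unitInterval) : ℝ) := by
    change 0 < 1 - c'
    linarith
  refine ⟨(1 - c') * (c' - q'), mul_pos hc (by linarith), fun r hr => ?_⟩
  let N : (ι → Bool) → ι → Bool := fun x i => !x i
  have hNc : Continuous N := continuous_pi fun i =>
    (continuous_of_discreteTopology (f := fun b : Bool => !b)).comp (continuous_apply i)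
  have hNm : Measurable N := measurable_pi_lambda _ fun i =>
    (measurable_of_countable fun b : Bool => !b).comp (measurable_pi_apply i)
  have hNN : ∀ x, N (N x) = x := fun x => by funext i; simp [N]
  have hNmap : ∀ s : unitInterval, (percMeasure ι s).map N = percMeasure ι (unitInterval.symm s) :=
    fun s => bernoulliProduct_map_not _
  let Ψ : (ι → Bool) × (Sym2 ι → Bool) → ι → Bool := fun z => N (openPairs Set.univ z.2 (N z.1))
  have hm := measurable_openPairs (Set.univ : Set (Sym2 ι))
  have hΨ : Measurable Ψ :=
    hNm.comp (hm.comp ((hNm.comp measurable_fst).prodMk measurable_snd))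
  have hprob : IsProbabilityMeasure (((percMeasure ι p).prod (bernoulliProduct r)).map Ψ) :=
    Measure.isProbabilityMeasure_map hΨ.aemeasurable
  have hle := h.measure_le (μ := percMeasure ι q)
      (ν := ((percMeasure ι p).prod (bernoulliProduct r)).map Ψ) fun B hB hup => by
    have hBm := hB.isOpen.measurableSet
    let B' : Set (ι → Bool) := N ⁻¹' Bᶜ
    have hB' : IsOpen B' := hB.compl.isOpen.preimage hNc
    have hup' : IsUpperSet B' := by
      intro x y hxy hx hy
      refine hx (hup ?_ hy)
      intro i
      have := hxy i
      simp only [N]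
      revert this
      cases x i <;> cases y i <;> simp
    have key := openPairs_univ_le (p := unitInterval.symm p) (c := unitInterval.symm c)
      (q := unitInterval.symm q) hc
      (by change 1 - (p : ℝ) ≤ 1 - c'; linarith) hr (by
        change (1 - c') + (1 - c') * (c' - q') / (1 - c') ≤ 1 - q'
        rw [mul_div_cancel_left₀ _ (show (1 - c' : ℝ) ≠ 0 from hc.ne')]
        linarith) hB' hup'
    rw [← hNmap q, Measure.map_apply hNm hB'.measurableSet, ← hNmap p] at key
    have e1 : N ⁻¹' B' = Bᶜ := by
      ext x; simp only [B', Set.mem_preimage, hNN]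
    have e2 : ((percMeasure ι p).map N).prod (bernoulliProduct r) =
        ((percMeasure ι p).prod (bernoulliProduct r)).map (Prod.map N id) := by
      rw [← Measure.map_prod_map _ _ hNm measurable_id, Measure.map_id]
    have hA : MeasurableSet {z : (ι → Bool) × (Sym2 ι → Bool) |
        openPairs Set.univ z.2 z.1 ∈ B'} := hm hB'.measurableSet
    rw [e1, e2, Measure.map_apply (hNm.prodMap measurable_id) hA] at key
    have e3 : (Prod.map N id ⁻¹' {z : (ι → Bool) × (Sym2 ι → Bool) |
        openPairs Set.univ z.2 z.1 ∈ B'}) = Ψ ⁻¹' Bᶜ := by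
      ext z; rfl
    rw [e3, ← Measure.map_apply hΨ hBm.compl, prob_compl_eq_one_sub hBm,
      prob_compl_eq_one_sub hBm] at key
    exact (ENNReal.sub_le_sub_iff_left prob_le_one ENNReal.one_ne_top).1 key
  rw [hq1, Measure.map_apply hΨ h.measurableSet] at hle
  exact (mem_ae_iff_prob_eq_one (hΨ h.measurableSet)).2 (le_antisymm prob_le_one hle)

end IsPercolationEvent

/-! ### Sums of independent exponential waiting times -/

/-- The density of the sum of `n + 1` independent exponential variables of parameter `r`. -/
noncomputable def erlangPDF (r : ℝ) (n : ℕ) (x : ℝ) : ENNReal :=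
  ENNReal.ofReal (if 0 ≤ x then r ^ (n + 1) * x ^ n / n.factorial * Real.exp (-(r * x)) else 0)

theorem measurable_erlangPDF (r : ℝ) (n : ℕ) : Measurable (erlangPDF r n) := by
  refine ENNReal.measurable_ofReal.comp (Measurable.ite measurableSet_Ici ?_ measurable_const)
  fun_prop

theorem erlangPDF_zero (r : ℝ) : erlangPDF r 0 = exponentialPDF r := by
  funext x
  simp [erlangPDF, exponentialPDF_eq]

/-- On `[0, x]` the two exponentials multiply to `exp (-(r * x))`, independent of the integration
variable, and only a power remains to be integrated. -/
theorem erlangPDF_lconvolution {r : ℝ} (hr : 0 < r) (n : ℕ) :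
    lconvolution (erlangPDF r n) (exponentialPDF r) volume = erlangPDF r (n + 1) := by
  funext x
  rw [lconvolution_def]
  by_cases hx : 0 ≤ x
  · have h1 : ∀ y, erlangPDF r n y * exponentialPDF r (-y + x) = (Set.Icc 0 x).indicator
        (fun y => ENNReal.ofReal (r ^ (n + 2) / n.factorial * Real.exp (-(r * x)) * y ^ n)) y := by
      intro y
      by_cases hy : y ∈ Set.Icc 0 x
      · have hy2 : 0 ≤ -y + x := by linarith [hy.2]
        have hy1 := hy.1
        rw [Set.indicator_of_mem hy, erlangPDF, exponentialPDF_eq, if_pos hy.1, if_pos hy2,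
          ← ENNReal.ofReal_mul (by positivity)]
        congr 1
        have : Real.exp (-(r * x)) = Real.exp (-(r * y)) * Real.exp (-(r * (-y + x))) := by
          rw [← Real.exp_add]; congr 1; ring
        rw [this]
        ring
      · rw [Set.indicator_of_notMem hy, erlangPDF, exponentialPDF_eq]
        by_cases hy1 : 0 ≤ y
        · have : ¬ 0 ≤ -y + x := fun h => hy ⟨hy1, by linarith⟩
          simp [this]
        · simp [hy1]
    simp_rw [h1]
    rw [lintegral_indicator measurableSet_Icc, ← ofReal_integral_eq_lintegral_ofReal]
    · rw [integral_Icc_eq_integral_Ioc, ← intervalIntegral.integral_of_le hx,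
        intervalIntegral.integral_const_mul, integral_pow, erlangPDF, if_pos hx]
      congr 1
      rw [Nat.factorial_succ]
      have : (n.factorial : ℝ) ≠ 0 := by positivity
      push_cast
      field_simp
      simp
    · exact (Continuous.integrableOn_Icc (by fun_prop))
    · refine (ae_restrict_iff' measurableSet_Icc).2 (ae_of_all _ fun y hy => ?_)
      have hy1 := hy.1
      exact mul_nonneg (by positivity) (by positivity)
  · have h1 : ∀ y, erlangPDF r n y * exponentialPDF r (-y + x) = 0 := by
      intro y
      rw [erlangPDF, exponentialPDF_eq]
      by_cases hy1 : 0 ≤ y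
      · have : ¬ 0 ≤ -y + x := fun h => hx (by linarith)
        simp [this]
      · simp [hy1]
    simp_rw [h1]
    simp [erlangPDF, hx]

/-- The rings form a Poisson process of constant intensity `r`: for nonnegative `x` the densities
sum to `r` by the exponential series. -/
theorem tsum_erlangPDF_le {r : ℝ} (hr : 0 < r) (x : ℝ) :
    ∑' n, erlangPDF r n x ≤ ENNReal.ofReal r := by
  by_cases hx : 0 ≤ x
  · have hs : HasSum (fun n : ℕ => r ^ (n + 1) * x ^ n / n.factorial * Real.exp (-(r * x))) r := by
      have h1 := NormedSpace.expSeries_div_hasSum_exp (r * x)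
      rw [← Real.exp_eq_exp_ℝ] at h1
      have h2 := (h1.mul_left r).mul_right (Real.exp (-(r * x)))
      rw [mul_assoc, ← Real.exp_add, add_neg_cancel, Real.exp_zero, mul_one] at h2
      refine h2.congr_fun ?_
      intro n
      ring
    simp only [erlangPDF, if_pos hx]
    rw [← ENNReal.ofReal_tsum_of_nonneg (fun n => by positivity) hs.summable, hs.tsum_eq]
  · simp [erlangPDF, hx]

section Sums

variable {Ω : Type*} [MeasurableSpace Ω] {μ : Measure Ω} [IsProbabilityMeasure μ] {r : ℝ}
  {X : ℕ → Ω → ℝ}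

theorem map_sum_range_eq_withDensity_erlangPDF (hr : 0 < r) (hX : ∀ n, Measurable (X n))
    (hlaw : ∀ n, μ.map (X n) = expMeasure r) (hind : iIndepFun X μ) (n : ℕ) :
    μ.map (fun x => ∑ m ∈ Finset.range (n + 1), X m x) = volume.withDensity (erlangPDF r n) := by
  induction n with
  | zero =>
    simp only [zero_add, Finset.sum_range_one]
    rw [erlangPDF_zero]
    exact hlaw 0
  | succ n ih =>
    have h1 : (fun x => ∑ m ∈ Finset.range (n + 1), X m x) = ∑ m ∈ Finset.range (n + 1), X m := by
      funext x; simp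
    have h2 : (fun x => ∑ m ∈ Finset.range (n + 1 + 1), X m x) =
        (∑ m ∈ Finset.range (n + 1), X m) + X (n + 1) := by
      funext x; simp [Finset.sum_range_succ]
    rw [h1] at ih
    rw [h2, (hind.indepFun_sum_range_succ hX (n + 1)).map_add_eq_map_conv_map
      (by fun_prop) (hX _), ih, hlaw, ← erlangPDF_lconvolution hr]
    exact conv_withDensity_eq_lconvolution (measurable_erlangPDF r n)
      (measurable_exponentialPDFReal r).ennreal_ofReal

theorem measure_sum_range_mem_eq_zero (hr : 0 < r) (hX : ∀ n, Measurable (X n))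
    (hlaw : ∀ n, μ.map (X n) = expMeasure r) (hind : iIndepFun X μ) (n : ℕ) (t : ℝ) :
    μ {x | ∑ m ∈ Finset.range (n + 1), X m x = t} = 0 := by
  have hm : Measurable fun x => ∑ m ∈ Finset.range (n + 1), X m x := by fun_prop
  have : μ.map (fun x => ∑ m ∈ Finset.range (n + 1), X m x) {t} = 0 := by
    rw [map_sum_range_eq_withDensity_erlangPDF hr hX hlaw hind]
    exact withDensity_absolutelyContinuous _ _ (by simp)
  rwa [Measure.map_apply hm (measurableSet_singleton _)] at this

/-- The expected number of rings of a clock of rate `r` in `(a, a + δ]` is at most `r * δ`. -/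
theorem tsum_measure_sum_range_mem_Ioc_le (hr : 0 < r) (hX : ∀ n, Measurable (X n))
    (hlaw : ∀ n, μ.map (X n) = expMeasure r) (hind : iIndepFun X μ) (a δ : ℝ) :
    ∑' n, μ {x | ∑ m ∈ Finset.range (n + 1), X m x ∈ Set.Ioc a (a + δ)} ≤
      ENNReal.ofReal (r * δ) := by
  have h1 : ∀ n, μ {x | ∑ m ∈ Finset.range (n + 1), X m x ∈ Set.Ioc a (a + δ)} =
      ∫⁻ x in Set.Ioc a (a + δ), erlangPDF r n x := by
    intro n
    have hm : Measurable fun x => ∑ m ∈ Finset.range (n + 1), X m x := by fun_prop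
    rw [← withDensity_apply _ measurableSet_Ioc,
      ← map_sum_range_eq_withDensity_erlangPDF hr hX hlaw hind, Measure.map_apply hm measurableSet_Ioc]
    rfl
  simp_rw [h1]
  rw [← lintegral_tsum fun n => (measurable_erlangPDF r n).aemeasurable]
  calc ∫⁻ x in Set.Ioc a (a + δ), ∑' n, erlangPDF r n x
      ≤ ∫⁻ _ in Set.Ioc a (a + δ), ENNReal.ofReal r := lintegral_mono fun x => tsum_erlangPDF_le hr x
    _ = ENNReal.ofReal (r * δ) := by
      rw [setLIntegral_const, Real.volume_Ioc, add_sub_cancel_left, ENNReal.ofReal_mul hr.le]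

end Sums

/-! ### Motion of the particles for fixed ringing times -/

section Motion

variable {ι : Type*} {R : ι → ι → Set ℝ}

theorem JumpsTo.eq_or_pos {i j : ι} {τ : ℝ} (h : JumpsTo R i τ j) :
    (τ = 0 ∧ j = i) ∨ (0 < τ ∧ ∃ k, τ ∈ R k j) := by
  induction h with
  | start => exact Or.inl ⟨rfl, rfl⟩
  | @jump τ σ j k _ hlt hσ _ ih =>
    refine Or.inr ⟨?_, j, hσ⟩
    rcases ih with ⟨h, -⟩ | ⟨h, -⟩ <;> linarith

theorem JumpsTo.nonneg {i j : ι} {τ : ℝ} (h : JumpsTo R i τ j) : 0 ≤ τ := by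
  rcases h.eq_or_pos with ⟨h, -⟩ | ⟨h, -⟩ <;> linarith

/-- Ringing times belong to unordered pairs, and clocks of different pairs with a common element
do not ring simultaneously. -/
structure IsClockSystem (R : ι → ι → Set ℝ) : Prop where
  symm : ∀ j k, R j k = R k j
  disjoint : ∀ j k l t, t ∈ R j k → t ∈ R j l → k = l

/-- Motion is deterministic backwards in time. Without a ring at `j` between the two arrivals, the
arrival times coincide; disjointness of the clocks then identifies the previous positions, and the
induction goes on from there. -/
theorem JumpsTo.eq_of_target_eq (hR : IsClockSystem R) {i i' j : ι} {τ τ' : ℝ}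
    (h : JumpsTo R i τ j) (h' : JumpsTo R i' τ' j)
    (hn : ∀ l, ∀ r ∈ R j l, ¬ (τ < r ∧ r ≤ τ')) (hn' : ∀ l, ∀ r ∈ R j l, ¬ (τ' < r ∧ r ≤ τ)) :
    i = i' := by
  have heq : ∀ {i i' j : ι} {τ τ' : ℝ}, JumpsTo R i τ j → JumpsTo R i' τ' j →
      (∀ l, ∀ r ∈ R j l, ¬ (τ < r ∧ r ≤ τ')) → τ' ≤ τ := by
    intro i i' j τ τ' h h' hn
    by_contra! hlt
    rcases h'.eq_or_pos with ⟨h0, -⟩ | ⟨-, k, hk⟩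
    · linarith [h.nonneg]
    · exact hn k τ' (hR.symm k j ▸ hk) ⟨hlt, le_rfl⟩
  induction h generalizing i' τ' with
  | start =>
    have : τ' = 0 := le_antisymm (heq JumpsTo.start h' hn) h'.nonneg
    rcases h'.eq_or_pos with ⟨-, h1⟩ | ⟨h1, -⟩
    · exact h1
    · linarith
  | @jump τ₀ σ j k hj hlt hσ hno ih =>
    have e : τ' = σ := le_antisymm (heq (hj.jump hlt hσ hno) h' hn) (heq h' (hj.jump hlt hσ hno) hn')
    subst e
    cases h' with
    | start => linarith [hj.nonneg]
    | @jump τ₁ _ j₁ _ hj₁ hlt₁ hσ₁ hno₁ =>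
      obtain rfl : j = j₁ := hR.disjoint k j j₁ τ' (hR.symm j k ▸ hσ) (hR.symm j₁ k ▸ hσ₁)
      exact ih hj₁ (fun l r hr hr' => hno l r hr ⟨hr'.1, lt_of_le_of_lt hr'.2 hlt₁⟩)
        (fun l r hr hr' => hno₁ l r hr ⟨hr'.1, lt_of_le_of_lt hr'.2 hlt⟩)

/-- Motion is deterministic forwards in time. The second clause says that an earlier stage of the
same trajectory has been ended by a ring; it excludes two different current positions and is what
makes the induction close. -/
theorem JumpsTo.eq_or_exists_ring (hR : IsClockSystem R) {i j j' : ι} {τ τ' : ℝ}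
    (h : JumpsTo R i τ j) (h' : JumpsTo R i τ' j') :
    (τ' = τ → j' = j) ∧ (τ' < τ → ∃ l, ∃ r ∈ R j' l, τ' < r ∧ r ≤ τ) := by
  induction h generalizing j' τ' with
  | start =>
    refine ⟨fun h0 => ?_, fun h0 => absurd h'.nonneg (not_le.2 h0)⟩
    rcases h'.eq_or_pos with ⟨-, h1⟩ | ⟨h1, -⟩
    · exact h1
    · linarith
  | @jump τ₀ σ j k hj hlt hσ hno ih =>
    -- After the stage at `τ₀`, the next stage of any trajectory from `i` is the one at `σ`.
    have key : τ₀ < τ' → τ' ≤ σ → τ' = σ ∧ j' = k := by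
      induction h' with
      | start => intro h1; linarith [hj.nonneg]
      | @jump τ₁ σ₁ j₁ k₁ hj₁ hlt₁ hσ₁ hno₁ ih₁ =>
        intro h1 h2
        rcases lt_trichotomy τ₁ τ₀ with h3 | h3 | h3
        · obtain ⟨l, r, hr, hr1, hr2⟩ := (ih hj₁).2 h3
          exact absurd ⟨hr1, lt_of_le_of_lt hr2 h1⟩ (hno₁ l r hr)
        · obtain rfl : j₁ = j := (ih hj₁).1 h3
          have e : σ₁ = σ := by
            by_contra hne
            exact hno k₁ σ₁ hσ₁ ⟨h1, lt_of_le_of_ne h2 hne⟩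
          subst e
          exact ⟨rfl, hR.disjoint _ _ _ _ hσ₁ hσ⟩
        · have := (ih₁ h3 (by linarith)).1
          linarith
    constructor
    · intro h1
      exact (key (by linarith) h1.le).2
    · intro h1
      rcases lt_trichotomy τ' τ₀ with h3 | h3 | h3
      · obtain ⟨l, r, hr, hr1, hr2⟩ := (ih h').2 h3
        exact ⟨l, r, hr, hr1, by linarith⟩
      · obtain rfl : j' = j := (ih h').1 h3
        exact ⟨k, σ, hσ, h1, le_rfl⟩
      · have := (key h3 h1.le).1
        linarith

theorem MovesTo.eq_of_target_eq (hR : IsClockSystem R) {i i' j : ι} {t : ℝ}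
    (h : MovesTo R i t j) (h' : MovesTo R i' t j) : i = i' := by
  obtain ⟨τ, hτ, hj, hn⟩ := h
  obtain ⟨τ', hτ', hj', hn'⟩ := h'
  exact hj.eq_of_target_eq hR hj' (fun l r hr hr' => hn l r hr ⟨hr'.1, hr'.2.trans hτ'⟩)
    (fun l r hr hr' => hn' l r hr ⟨hr'.1, hr'.2.trans hτ⟩)

theorem MovesTo.eq_of_source_eq (hR : IsClockSystem R) {i j j' : ι} {t : ℝ}
    (h : MovesTo R i t j) (h' : MovesTo R i t j') : j = j' := by
  obtain ⟨τ, hτ, hj, hn⟩ := h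
  obtain ⟨τ', hτ', hj', hn'⟩ := h'
  rcases lt_trichotomy τ τ' with hlt | heq | hlt
  · obtain ⟨l, r, hr, hr1, hr2⟩ := (hj'.eq_or_exists_ring hR hj).2 hlt
    exact absurd ⟨hr1, hr2.trans hτ'⟩ (hn l r hr)
  · exact (hj'.eq_or_exists_ring hR hj).1 heq
  · obtain ⟨l, r, hr, hr1, hr2⟩ := (hj.eq_or_exists_ring hR hj').2 hlt
    exact absurd ⟨hr1, hr2.trans hτ⟩ (hn' l r hr)

theorem MovesTo.extend {i j : ι} {s t : ℝ} (hst : s ≤ t) (h : MovesTo R i s j)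
    (hn : ∀ l, ∀ r ∈ R j l, ¬ (s < r ∧ r ≤ t)) : MovesTo R i t j := by
  obtain ⟨τ, hτ, hj, hno⟩ := h
  refine ⟨τ, hτ.trans hst, hj, fun l r hr hr' => ?_⟩
  rcases le_or_gt r s with h1 | h1
  · exact hno l r hr ⟨hr'.1, h1⟩
  · exact hn l r hr ⟨h1, hr'.2⟩

theorem MovesTo.restrict (hR : IsClockSystem R) {i j : ι} {s t : ℝ} (hs : 0 ≤ s) (hst : s ≤ t)
    (h : MovesTo R i t j) (hn : ∀ l, ∀ r ∈ R j l, ¬ (s < r ∧ r ≤ t)) : MovesTo R i s j := by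
  obtain ⟨τ, hτ, hj, hno⟩ := h
  refine ⟨τ, ?_, hj, fun l r hr hr' => hno l r hr ⟨hr'.1, hr'.2.trans hst⟩⟩
  rcases hj.eq_or_pos with ⟨h0, -⟩ | ⟨-, k, hk⟩
  · exact h0.le.trans hs
  · by_contra! hlt
    exact hn k τ (hR.symm k j ▸ hk) ⟨hlt, hτ⟩

theorem exclusionState_eq_of_no_ring (hR : IsClockSystem R) (η : ι → Bool) {j : ι} {s t : ℝ}
    (hs : 0 ≤ s) (hst : s ≤ t) (hn : ∀ l, ∀ r ∈ R j l, ¬ (s < r ∧ r ≤ t)) :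
    exclusionState R η t j = exclusionState R η s j := by
  classical
  simp only [exclusionState]
  congr 1
  exact propext (exists_congr fun i => and_congr_left fun _ =>
    ⟨fun h => h.restrict hR hs hst hn, fun h => h.extend hst hn⟩)

/-- During the time interval `(a, b]`, every clock rings finitely often, and the particles of a
finite set that contains any given element interact among themselves only. -/
structure IsFiniteWindow (R : ι → ι → Set ℝ) (a b : ℝ) : Prop where
  rings_finite : ∀ j k, (R j k ∩ Set.Ioc a b).Finite
  exists_finite : ∀ j, ∃ C : Set ι, C.Finite ∧ j ∈ C ∧
    ∀ k ∈ C, ∀ l, (R k l ∩ Set.Ioc a b).Nonempty → l ∈ C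

/-- Trace the position back in time: the last ring at `k` tells which neighbour `l` the particle
came from, and the search resumes at `l` just before that ring. All this happens inside the finite
set `C`, so the number of earlier rings in `T` decreases strictly. -/
theorem IsFiniteWindow.exists_movesTo (hR : IsClockSystem R) {a b : ℝ} (hw : IsFiniteWindow R a b)
    (ha : ∀ j, ∃ i, MovesTo R i a j) {t : ℝ} (hat : a ≤ t) (htb : t ≤ b) (j : ι) :
    ∃ i, MovesTo R i t j := by
  obtain ⟨C, hC, hjC, hcl⟩ := hw.exists_finite j
  let T : Set ℝ := ⋃ k ∈ C, ⋃ l ∈ C, R k l ∩ Set.Ioc a b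
  have hT : T.Finite := hC.biUnion fun k _ => hC.biUnion fun l _ => hw.rings_finite k l
  have hmem : ∀ k ∈ C, ∀ l, ∀ r ∈ R k l, a < r → r ≤ b → r ∈ T ∧ l ∈ C := by
    intro k hk l r hr h1 h2
    have hl : l ∈ C := hcl k hk l ⟨r, hr, h1, h2⟩
    exact ⟨Set.mem_biUnion hk (Set.mem_biUnion hl ⟨hr, h1, h2⟩), hl⟩
  have hTgt : ∀ r ∈ T, a < r := by
    intro r hr
    simp only [T, Set.mem_iUnion] at hr
    obtain ⟨k, _, l, _, hr⟩ := hr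
    exact hr.2.1
  have main : ∀ n : ℕ, ∀ t, a ≤ t → t ≤ b → {r ∈ T | r ≤ t}.ncard = n → ∀ k ∈ C,
      ∃ i, MovesTo R i t k := by
    intro n
    induction n using Nat.strong_induction_on with
    | _ n ih =>
      intro t hat htb hn k hk
      by_cases hno : ∀ l, ∀ r ∈ R k l, ¬ (a < r ∧ r ≤ t)
      · obtain ⟨i, hi⟩ := ha k
        exact ⟨i, hi.extend hat hno⟩
      · have hfin : {r | r ∈ T ∧ r ≤ t ∧ ∃ l, r ∈ R k l}.Finite := hT.subset fun r hr => hr.1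
        have hne : {r | r ∈ T ∧ r ≤ t ∧ ∃ l, r ∈ R k l}.Nonempty := by
          push Not at hno
          obtain ⟨l, r, hr, h1, h2⟩ := hno
          exact ⟨r, (hmem k hk l r hr h1 (h2.trans htb)).1, h2, l, hr⟩
        obtain ⟨σ, ⟨hσT, hσt, l, hσ⟩, hmax⟩ := Set.exists_max_image _ id hfin hne
        have haσ := hTgt σ hσT
        have hl : l ∈ C := (hmem k hk l σ hσ haσ (hσt.trans htb)).2
        -- The time `t'` is the last ring in `T` before `σ`, or `a` if there is none; nothing in `C`
        -- rings strictly between `t'` and `σ`.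
        have hfin' : {r | (r ∈ T ∨ r = a) ∧ r < σ}.Finite :=
          (hT.union (Set.finite_singleton a)).subset fun r hr => hr.1
        obtain ⟨t', ⟨ht'T, ht'σ⟩, hmax'⟩ :=
          Set.exists_max_image _ id hfin' ⟨a, Or.inr rfl, haσ⟩
        have hat' : a ≤ t' := hmax' a ⟨Or.inr rfl, haσ⟩
        have hcard : {r ∈ T | r ≤ t'}.ncard < n := by
          rw [← hn]
          refine Set.ncard_lt_ncard ⟨fun r hr => ⟨hr.1, by linarith [hr.2]⟩, fun hsub => ?_⟩
            (hT.subset fun r hr => hr.1)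
          have := (hsub ⟨hσT, hσt⟩ : σ ∈ T ∧ σ ≤ t').2
          linarith
        obtain ⟨i, τ, hτ, hj, hno'⟩ := ih _ hcard t' hat' (by linarith) rfl l hl
        refine ⟨i, σ, hσt, hj.jump (lt_of_le_of_lt hτ ht'σ) (hR.symm k l ▸ hσ) ?_, ?_⟩
        · rintro m r hr ⟨h1, h2⟩
          rcases le_or_gt r t' with h3 | h3
          · exact hno' m r hr ⟨h1, h3⟩
          · have hrT := (hmem l hl m r hr (by linarith) (by linarith)).1
            have : r ≤ t' := hmax' r ⟨Or.inl hrT, h2⟩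
            linarith
        · rintro m r hr ⟨h1, h2⟩
          have hrT := (hmem k hk m r hr (by linarith) (by linarith)).1
          have : r ≤ σ := hmax r ⟨hrT, h2, m, hr⟩
          linarith
  exact main _ t hat htb rfl j hjC

theorem exists_movesTo_of_isFiniteWindow (hR : IsClockSystem R) {δ : ℝ} (hδ : 0 ≤ δ)
    (hw : ∀ n : ℕ, IsFiniteWindow R (n * δ) ((n + 1) * δ)) (n : ℕ) (j : ι) :
    ∃ i, MovesTo R i (n * δ) j := by
  induction n generalizing j with
  | zero =>
    refine ⟨j, 0, by simp, JumpsTo.start, ?_⟩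
    rintro l r - ⟨h1, h2⟩
    simp only [Nat.cast_zero, zero_mul] at h2
    linarith
  | succ n ih =>
    refine (hw n).exists_movesTo hR ih ?_ ?_ j <;> push_cast <;> nlinarith

/-- At time `t`, the exclusion process is a permutation of its initial configuration. -/
theorem exists_injective_exclusionState_eq (hR : IsClockSystem R) {t : ℝ}
    (h : ∀ j, ∃ i, MovesTo R i t j) :
    ∃ f : ι → ι, f.Injective ∧ ∀ η j, exclusionState R η t j = η (f j) := by
  classical
  choose f hf using h
  refine ⟨f, fun j j' hjj' => ?_, fun η j => ?_⟩
  · have h1 := hf j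
    rw [hjj'] at h1
    exact h1.eq_of_source_eq hR (hf j')
  · have : (∃ i, MovesTo R i t j ∧ η i = true) ↔ η (f j) = true := by
      constructor
      · rintro ⟨i, hi, hη⟩
        rwa [(hf j).eq_of_target_eq hR hi]
      · exact fun hη => ⟨f j, hf j, hη⟩
    simp only [exclusionState, this]
    simp

end Motion

/-! ### Measurability of the exclusion process -/

section Measurability

variable {ι : Type*} (K : ι → ι → ℝ)

/-- The time of the ring number `n` of the clock of the pair `e`. -/
def ringTime (W : Sym2 ι → ℕ → ℝ) (e : Sym2 ι) (n : ℕ) : ℝ := ∑ m ∈ Finset.range (n + 1), W e m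

theorem measurable_ringTime (e : Sym2 ι) (n : ℕ) :
    Measurable fun W : Sym2 ι → ℕ → ℝ => ringTime W e n := by
  unfold ringTime
  fun_prop

theorem mem_ringTimes {W : Sym2 ι → ℕ → ℝ} {i j : ι} {t : ℝ} :
    t ∈ ringTimes K W i j ↔ 0 < K i j ∧ ∃ n, t = ringTime W s(i, j) n := Iff.rfl

/-- A label of the last jump of a particle: `none` if there was no jump, and `(j, k, n)` for the
jump from `j` to `k` at the ring number `n`. -/
abbrev JumpLabel (ι : Type*) := Option (ι × ι × ℕ)

/-- The position after the jump, for a particle that starts at `i`. -/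
def JumpLabel.position (i : ι) : JumpLabel ι → ι
  | none => i
  | some z => z.2.1

/-- The time of the jump. -/
def JumpLabel.time (W : Sym2 ι → ℕ → ℝ) : JumpLabel ι → ℝ
  | none => 0
  | some z => ringTime W s(z.1, z.2.1) z.2.2

theorem JumpLabel.measurable_time (q : JumpLabel ι) :
    Measurable fun W : Sym2 ι → ℕ → ℝ => q.time W := by
  cases q with
  | none => exact measurable_const
  | some z => exact measurable_ringTime _ _

/-- The waiting times for which `q` is the label of the jump number `m` of the particle that starts
at `i`. -/
def jumpSet (i : ι) : ℕ → JumpLabel ι → Set (Sym2 ι → ℕ → ℝ)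
  | 0, q => {_W | q = none}
  | m + 1, q => {W | ∃ z, q = some z ∧ 0 < K z.1 z.2.1 ∧
      ∃ q' : JumpLabel ι, q'.position i = z.1 ∧ W ∈ jumpSet i m q' ∧ q'.time W < q.time W ∧
        ∀ l n, ¬ (0 < K z.1 l ∧ q'.time W < ringTime W s(z.1, l) n ∧
          ringTime W s(z.1, l) n < q.time W)}

theorem measurableSet_jumpSet [Countable ι] (i : ι) (m : ℕ) (q : JumpLabel ι) :
    MeasurableSet (jumpSet K i m q) := by
  induction m generalizing q with
  | zero => exact MeasurableSet.const _
  | succ m ih =>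
    simp only [jumpSet]
    refine MeasurableSet.congr (s := ⋃ z : ι × ι × ℕ, {_W | q = some z} ∩ ({_W | 0 < K z.1 z.2.1} ∩
      ⋃ q' : JumpLabel ι, {_W | q'.position i = z.1} ∩ (jumpSet K i m q' ∩
        ({W | q'.time W < q.time W} ∩ ⋂ l, ⋂ n, ({_W | 0 < K z.1 l} ∩
          ({W | q'.time W < ringTime W s(z.1, l) n} ∩
            {W | ringTime W s(z.1, l) n < q.time W}))ᶜ)))) ?_ ?_
    · refine .iUnion fun z => (MeasurableSet.const _).inter ((MeasurableSet.const _).inter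
        (.iUnion fun q' => (MeasurableSet.const _).inter ((ih q').inter (.inter ?_
          (.iInter fun l => .iInter fun n => ((MeasurableSet.const _).inter
            (.inter ?_ ?_)).compl)))))
      · exact measurableSet_lt q'.measurable_time q.measurable_time
      · exact measurableSet_lt q'.measurable_time (measurable_ringTime _ _)
      · exact measurableSet_lt (measurable_ringTime _ _) q.measurable_time
    · ext W
      simp only [Set.mem_iUnion, Set.mem_inter_iff, Set.mem_ofPred_eq, Set.mem_iInter,
        Set.mem_compl_iff]

/-- Labels replace the existential over real jump times by one over a countable type, so that events
about trajectories become countable unions. -/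
theorem jumpsTo_iff {W : Sym2 ι → ℕ → ℝ} {i j : ι} {τ : ℝ} :
    JumpsTo (ringTimes K W) i τ j ↔
      ∃ m, ∃ q : JumpLabel ι, W ∈ jumpSet K i m q ∧ q.time W = τ ∧ q.position i = j := by
  constructor
  · intro h
    induction h with
    | start => exact ⟨0, none, rfl, rfl, rfl⟩
    | @jump τ σ j k hj hlt hσ hno ih =>
      obtain ⟨m, q, hq, hτ, hpos⟩ := ih
      obtain ⟨hK, n, rfl⟩ := hσ
      refine ⟨m + 1, some (j, k, n), ⟨(j, k, n), rfl, hK, q, hpos, hq, ?_, ?_⟩, rfl, rfl⟩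
      · rw [hτ]; exact hlt
      · rintro l n' ⟨h1, h2, h3⟩
        rw [hτ] at h2
        exact hno l _ ⟨h1, n', rfl⟩ ⟨h2, h3⟩
  · rintro ⟨m, q, hq, rfl, rfl⟩
    induction m generalizing q with
    | zero =>
      obtain rfl : q = none := hq
      exact JumpsTo.start
    | succ m ih =>
      obtain ⟨⟨j, k, n⟩, rfl, hK, q', hpos, hq', hlt, hno⟩ := hq
      have h := ih q' hq'
      rw [hpos] at h
      refine h.jump hlt ⟨hK, n, rfl⟩ ?_
      rintro l r ⟨hKl, n', rfl⟩ ⟨h1, h2⟩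
      exact hno l n' ⟨hKl, h1, h2⟩

theorem measurableSet_movesTo [Countable ι] (i j : ι) (t : ℝ) :
    MeasurableSet {W | MovesTo (ringTimes K W) i t j} := by
  refine MeasurableSet.congr (s := ⋃ m, ⋃ q : JumpLabel ι, jumpSet K i m q ∩
    ({_W | q.position i = j} ∩ ({W | q.time W ≤ t} ∩ ⋂ l, ⋂ n, ({_W | 0 < K j l} ∩
          ({W | q.time W < ringTime W s(j, l) n} ∩ {W | ringTime W s(j, l) n ≤ t}))ᶜ))) ?_ ?_
  · refine .iUnion fun m => .iUnion fun q => (measurableSet_jumpSet K i m q).inter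
      ((MeasurableSet.const _).inter (.inter ?_ (.iInter fun l => .iInter fun n =>
        ((MeasurableSet.const _).inter (.inter ?_ ?_)).compl)))
    · exact measurableSet_le q.measurable_time measurable_const
    · exact measurableSet_lt q.measurable_time (measurable_ringTime _ _)
    · exact measurableSet_le (measurable_ringTime _ _) measurable_const
  · ext W
    simp only [Set.mem_iUnion, Set.mem_inter_iff, Set.mem_ofPred_eq, Set.mem_iInter,
      Set.mem_compl_iff]
    constructor
    · rintro ⟨m, q, hq, hpos, ht, hno⟩
      refine ⟨q.time W, ht, (jumpsTo_iff K).2 ⟨m, q, hq, rfl, hpos⟩, ?_⟩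
      rintro l r ⟨hK, n, rfl⟩ ⟨h1, h2⟩
      exact hno l n ⟨hK, h1, h2⟩
    · rintro ⟨τ, hτ, hj, hno⟩
      obtain ⟨m, q, hq, rfl, hpos⟩ := (jumpsTo_iff K).1 hj
      exact ⟨m, q, hq, hpos, hτ, fun l n h => hno l _ ⟨h.1, n, rfl⟩ h.2⟩

theorem measurable_exclusionState [Countable ι] (t : ℝ) :
    Measurable fun z : (ι → Bool) × (Sym2 ι → ℕ → ℝ) =>
      exclusionState (ringTimes K z.2) z.1 t := by
  classical
  refine measurable_pi_lambda _ fun j => measurable_to_bool ?_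
  refine MeasurableSet.congr (s := ⋃ i, (Prod.snd ⁻¹' {W | MovesTo (ringTimes K W) i t j} ∩
    (fun z : (ι → Bool) × (Sym2 ι → ℕ → ℝ) => z.1 i) ⁻¹' {true})) ?_ ?_
  · refine .iUnion fun i => (measurable_snd (measurableSet_movesTo K i j t)).inter ?_
    exact ((measurable_pi_apply i).comp measurable_fst) (measurableSet_singleton _)
  · ext z
    simp [exclusionState]

/-- Whether the clock of the pair `e` rings in `(a, b]`. -/
noncomputable def ringsIn (a b : ℝ) (W : Sym2 ι → ℕ → ℝ) (e : Sym2 ι) : Bool :=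
  open Classical in
  decide (∃ i j, e = s(i, j) ∧ (ringTimes K W i j ∩ Set.Ioc a b).Nonempty)

variable {K}

theorem ringsIn_mk (hK : IsSymmTransitionMatrix K) (a b : ℝ) (W : Sym2 ι → ℕ → ℝ) (i j : ι) :
    ringsIn K a b W s(i, j) = true ↔ (ringTimes K W i j ∩ Set.Ioc a b).Nonempty := by
  simp only [ringsIn, decide_eq_true_eq]
  constructor
  · rintro ⟨i', j', h, h'⟩
    rw [Sym2.eq_iff] at h
    rcases h with ⟨rfl, rfl⟩ | ⟨rfl, rfl⟩
    · exact h'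
    · simpa only [ringTimes, hK.symm j i, Sym2.eq_swap (a := j) (b := i)] using h'
  · exact fun h => ⟨i, j, rfl, h⟩

theorem ringsIn_iff (hK : IsSymmTransitionMatrix K) (a b : ℝ) (W : Sym2 ι → ℕ → ℝ) (i j : ι) :
    ringsIn K a b W s(i, j) = true ↔ 0 < K i j ∧ ∃ n, ringTime W s(i, j) n ∈ Set.Ioc a b := by
  rw [ringsIn_mk hK]
  constructor
  · rintro ⟨t, ⟨h, n, rfl⟩, ht⟩
    exact ⟨h, n, ht⟩
  · rintro ⟨h, n, hn⟩
    exact ⟨_, ⟨h, n, rfl⟩, hn⟩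

end Measurability

/-! ### Subcritical random graphs of pairs -/

section RandomPairs

variable {ι : Type*}

/-- The pairs of consecutive elements of `j :: l`. -/
def consecutivePairs : ι → List ι → List (Sym2 ι)
  | _, [] => []
  | j, k :: l => s(j, k) :: consecutivePairs k l

theorem consecutivePairs_support_tail {G : SimpleGraph ι} {u v : ι} (p : G.Walk u v) :
    consecutivePairs u p.support.tail = p.edges := by
  induction p with
  | nil => rfl
  | @cons u v w h p ih =>
    rw [SimpleGraph.Walk.support_cons, List.tail_cons, ← SimpleGraph.Walk.cons_tail_support p,
      SimpleGraph.Walk.edges_cons, ← ih]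
    rfl

/-- The product of the rates of the pairs of consecutive elements of `j :: l`. -/
noncomputable def pathWeight (r : Sym2 ι → unitInterval) (j : ι) (l : List ι) : ENNReal :=
  ((consecutivePairs j l).map fun e => ENNReal.ofReal (r e)).prod

/-- Independence gives the product only when the pairs are distinct, hence the `Nodup` condition
inside the event. -/
theorem bernoulliProduct_consecutivePairs_le (r : Sym2 ι → unitInterval) (j : ι) (l : List ι) :
    bernoulliProduct r {b | (consecutivePairs j l).Nodup ∧ ∀ e ∈ consecutivePairs j l, b e = true} ≤
      pathWeight r j l := by
  classical
  by_cases hnd : (consecutivePairs j l).Nodup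
  · have h1 : {b : Sym2 ι → Bool | (consecutivePairs j l).Nodup ∧
        ∀ e ∈ consecutivePairs j l, b e = true} =
        Set.pi ((consecutivePairs j l).toFinset : Set (Sym2 ι)) fun _ => {true} := by
      ext b
      simp [hnd, Set.mem_pi]
    rw [h1, bernoulliProduct, Measure.infinitePi_pi _ fun _ _ => measurableSet_singleton _,
      List.prod_toFinset _ hnd, pathWeight]
    refine le_of_eq (congrArg _ (List.map_congr_left fun e _ => ?_))
    exact bernoulliMeasure_true_false_apply_true _
  · simp [hnd]

theorem PairRateLe.tsum_le {r : Sym2 ι → unitInterval} {δ : ℝ} (hr : PairRateLe r δ) (j : ι) :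
    ∑' k, ENNReal.ofReal (r s(j, k)) ≤ ENNReal.ofReal δ := by
  classical
  rw [ENNReal.tsum_eq_iSup_sum]
  refine iSup_le fun F => ?_
  rw [← ENNReal.ofReal_sum_of_nonneg fun k _ => (r s(j, k)).2.1]
  refine ENNReal.ofReal_le_ofReal ?_
  have hinj : Function.Injective fun k => s(j, k) := fun k k' h => Sym2.congr_right.1 h
  have := hr (F.image fun k => s(j, k)) j (by simp)
  rwa [Finset.sum_image hinj.injOn] at this

/-- Summing over the first step costs a factor `δ`, uniformly in the starting point. -/
theorem tsum_pathWeight_length_le {r : Sym2 ι → unitInterval} {δ : ℝ} (hr : PairRateLe r δ) (n : ℕ)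
    (j : ι) :
    ∑' l : List ι, (if l.length = n then pathWeight r j l else 0) ≤ ENNReal.ofReal δ ^ n := by
  induction n generalizing j with
  | zero =>
    rw [tsum_eq_single []]
    · simp [pathWeight, consecutivePairs]
    · intro l hl
      simp [List.length_eq_zero_iff, hl]
  | succ n ih =>
    have hinj : Function.Injective fun z : ι × List ι => z.1 :: z.2 := by
      rintro ⟨a, l⟩ ⟨b, m⟩ h
      simpa using h
    rw [← hinj.tsum_eq (f := fun l : List ι => if l.length = n + 1 then pathWeight r j l else 0),
      ENNReal.tsum_prod']
    · have h1 : ∀ k l, (if (k :: l : List ι).length = n + 1 then pathWeight r j (k :: l) else 0) =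
          ENNReal.ofReal (r s(j, k)) * (if l.length = n then pathWeight r k l else 0) := by
        intro k l
        by_cases h : l.length = n <;> simp [h, pathWeight, consecutivePairs]
      simp only [h1, ENNReal.tsum_mul_left]
      calc ∑' k, ENNReal.ofReal (r s(j, k)) * ∑' l : List ι, _
          ≤ ∑' k, ENNReal.ofReal (r s(j, k)) * ENNReal.ofReal δ ^ n :=
            ENNReal.tsum_le_tsum fun k => mul_le_mul_right (ih k) _
        _ ≤ ENNReal.ofReal δ * ENNReal.ofReal δ ^ n := by
            rw [ENNReal.tsum_mul_right]
            exact mul_le_mul_left (hr.tsum_le j) _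
        _ = _ := (pow_succ' _ _).symm
    · intro l hl
      cases l with
      | nil => simp at hl
      | cons k l => exact ⟨(k, l), rfl⟩

theorem tsum_pathWeight_lt_top {r : Sym2 ι → unitInterval} {δ : ℝ} (hr : PairRateLe r δ)
    (hδ : δ < 1) (j : ι) : ∑' l : List ι, pathWeight r j l < ⊤ := by
  have h1 : ∀ l : List ι, pathWeight r j l =
      ∑' n : ℕ, (if l.length = n then pathWeight r j l else 0) := fun l => by
    rw [tsum_eq_single l.length]
    · simp
    · intro n hn
      simp [hn.symm]
  calc ∑' l : List ι, pathWeight r j l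
      = ∑' l : List ι, ∑' n : ℕ, (if l.length = n then pathWeight r j l else 0) := tsum_congr h1
    _ = ∑' n : ℕ, ∑' l : List ι, (if l.length = n then pathWeight r j l else 0) :=
        ENNReal.tsum_comm
    _ ≤ ∑' n : ℕ, ENNReal.ofReal δ ^ n :=
        ENNReal.tsum_le_tsum fun n => tsum_pathWeight_length_le hr n j
    _ < ⊤ := by
        rw [ENNReal.tsum_geometric, ENNReal.inv_lt_top, tsub_pos_iff_lt]
        exact ENNReal.ofReal_lt_one.2 hδ

/-- If the expected number of open pairs at every element is less than one, then the clusters of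
the graph of open pairs are finite. -/
theorem PairRateLe.ae_exists_finite [Countable ι] {r : Sym2 ι → unitInterval} {δ : ℝ}
    (hr : PairRateLe r δ) (hδ : δ < 1) :
    ∀ᵐ b ∂bernoulliProduct r, ∀ j, ∃ C : Set ι, C.Finite ∧ j ∈ C ∧
      ∀ k ∈ C, ∀ l, b s(k, l) = true → l ∈ C := by
  rw [ae_all_iff]
  intro j
  have hsum : ∑' l : List ι, bernoulliProduct r
      {b | (consecutivePairs j l).Nodup ∧ ∀ e ∈ consecutivePairs j l, b e = true} ≠ ⊤ :=
    ((ENNReal.tsum_le_tsum fun l => bernoulliProduct_consecutivePairs_le r j l).trans_lt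
      (tsum_pathWeight_lt_top hr hδ j)).ne
  -- By Borel–Cantelli only finitely many open trails start at `j`. Every element of its cluster is
  -- the endpoint of a path, whose edges are distinct, so the cluster is finite.
  filter_upwards [ae_finite_setOfPred_mem hsum] with b hb
  let H : SimpleGraph ι := SimpleGraph.fromEdgeSet {e | b e = true}
  refine ⟨{k | H.Reachable j k}, ?_, SimpleGraph.Reachable.refl _, ?_⟩
  · classical
    refine (hb.image fun l => (j :: l).getLast (by simp)).subset ?_
    rintro k ⟨p⟩
    have hpath := p.toPath.2
    set q := (p.toPath : H.Walk j k)
    refine ⟨q.support.tail, ⟨?_, ?_⟩, ?_⟩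
    · rw [consecutivePairs_support_tail]
      exact hpath.isTrail.edges_nodup
    · rw [consecutivePairs_support_tail]
      intro e he
      have := q.edges_subset_edgeSet he
      rw [SimpleGraph.edgeSet_fromEdgeSet] at this
      exact this.1
    · simp
  · intro k hk l hl
    by_cases hkl : k = l
    · exact hkl ▸ hk
    · refine SimpleGraph.Reachable.trans hk (SimpleGraph.Adj.reachable ?_)
      rw [SimpleGraph.fromEdgeSet_adj]
      exact ⟨hl, hkl⟩

end RandomPairs

/-! ### Almost sure properties of the clocks -/

namespace IsEquilibriumInput

variable {ι Ω : Type*} [MeasurableSpace Ω] {μ : Measure Ω}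
  {K : ι → ι → ℝ} {p : unitInterval} {η₀ : Ω → ι → Bool} {W : Sym2 ι → ℕ → Ω → ℝ}

theorem measurable_waits (h : IsEquilibriumInput μ K p η₀ W) :
    Measurable fun x s n => W s n x :=
  measurable_pi_lambda _ fun s => measurable_pi_lambda _ fun n => h.measurable_wait s n

theorem iIndepFun_wait (h : IsEquilibriumInput μ K p η₀ W) (s : Sym2 ι) :
    iIndepFun (fun n => W s n) μ :=
  h.indep_wait.precomp (g := fun n => (s, n)) fun _ _ hnm => congrArg Prod.snd hnm

variable [IsProbabilityMeasure μ]

/-- Currying the product over `Sym2 ι × ℕ` groups the waiting times clock by clock. -/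
theorem iIndepFun_clocks (h : IsEquilibriumInput μ K p η₀ W) :
    iIndepFun (fun s x n => W s n x) μ := by
  have hm : ∀ q : Sym2 ι × ℕ, Measurable (W q.1 q.2) := fun q => h.measurable_wait _ _
  have hm' : ∀ s, Measurable fun x n => W s n x :=
    fun s => measurable_pi_lambda _ fun n => h.measurable_wait s n
  have hp : ∀ s n, IsProbabilityMeasure (μ.map (W s n)) :=
    fun s n => Measure.isProbabilityMeasure_map (h.measurable_wait s n).aemeasurable
  rw [iIndepFun_iff_map_fun_eq_infinitePi_map hm']
  have h1 := (iIndepFun_iff_map_fun_eq_infinitePi_map hm).1 h.indep_wait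
  have h2 := congrArg (Measure.map (MeasurableEquiv.curry (Sym2 ι) ℕ ℝ)) h1
  rw [Measure.map_map (MeasurableEquiv.measurable _) (measurable_pi_lambda _ hm),
    Measure.infinitePi_map_curry fun s n => μ.map (W s n)] at h2
  refine Eq.trans ?_ (h2.trans ?_)
  · rfl
  · congr 1
    funext s
    exact ((iIndepFun_iff_map_fun_eq_infinitePi_map (h.measurable_wait s)).1
      (h.iIndepFun_wait s)).symm

theorem tsum_measure_ringTime_le (h : IsEquilibriumInput μ K p η₀ W) {i j : ι} (hK : 0 < K i j)
    (a δ : ℝ) :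
    ∑' n, μ {x | ringTime (fun s n => W s n x) s(i, j) n ∈ Set.Ioc a (a + δ)} ≤
      ENNReal.ofReal (K i j * δ) :=
  tsum_measure_sum_range_mem_Ioc_le hK (h.measurable_wait _) (h.law_wait i j hK)
    (h.iIndepFun_wait _) a δ

theorem ae_rings_finite [Countable ι] (h : IsEquilibriumInput μ K p η₀ W) (a δ : ℝ) :
    ∀ᵐ x ∂μ, ∀ i j, (ringTimes K (fun s n => W s n x) i j ∩ Set.Ioc a (a + δ)).Finite := by
  simp only [ae_all_iff]
  intro i j
  by_cases hK : 0 < K i j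
  · filter_upwards [ae_finite_setOfPred_mem
      ((h.tsum_measure_ringTime_le hK a δ).trans_lt ENNReal.ofReal_lt_top).ne] with x hx
    refine (hx.image fun n => ringTime (fun s n => W s n x) s(i, j) n).subset ?_
    rintro t ⟨⟨-, n, rfl⟩, ht⟩
    exact ⟨n, ht, rfl⟩
  · refine ae_of_all _ fun x => ?_
    convert Set.finite_empty
    ext t
    simp [mem_ringTimes, hK]

/-- By Fubini: the two ring times are independent, and the first has no atoms. -/
theorem measure_ringTime_eq (h : IsEquilibriumInput μ K p η₀ W) {i j k l : ι} (hij : 0 < K i j)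
    (hne : s(i, j) ≠ s(k, l)) (n m : ℕ) :
    μ {x | ringTime (fun s n => W s n x) s(i, j) n = ringTime (fun s n => W s n x) s(k, l) m} =
      0 := by
  have hsum : ∀ n : ℕ, Measurable fun v : ℕ → ℝ => ∑ m ∈ Finset.range (n + 1), v m :=
    fun n => by fun_prop
  have hmX : ∀ s n, Measurable fun x => ringTime (fun s n => W s n x) s n :=
    fun s n => (measurable_ringTime s n).comp h.measurable_waits
  have hind : IndepFun (fun x => ringTime (fun s n => W s n x) s(i, j) n)
      (fun x => ringTime (fun s n => W s n x) s(k, l) m) μ :=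
    (h.iIndepFun_clocks.indepFun hne).comp (hsum n) (hsum m)
  have hD : MeasurableSet {z : ℝ × ℝ | z.1 = z.2} := measurableSet_eq_fun measurable_fst measurable_snd
  have h1 := (indepFun_iff_map_prod_eq_prod_map_map (hmX _ n).aemeasurable
    (hmX _ m).aemeasurable).1 hind
  have hp : IsProbabilityMeasure (μ.map fun x => ringTime (fun s n => W s n x) s(k, l) m) :=
    Measure.isProbabilityMeasure_map (hmX _ m).aemeasurable
  have hp' : IsProbabilityMeasure (μ.map fun x => ringTime (fun s n => W s n x) s(i, j) n) :=
    Measure.isProbabilityMeasure_map (hmX _ n).aemeasurable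
  have h2 := congrArg (fun ν => ν {z : ℝ × ℝ | z.1 = z.2}) h1
  simp only [Measure.map_apply ((hmX _ n).prodMk (hmX _ m)) hD] at h2
  refine h2.trans ?_
  rw [Measure.prod_apply_symm hD]
  refine lintegral_eq_zero_of_ae_eq_zero (ae_of_all _ fun t => ?_)
  change μ.map _ _ = 0
  rw [Measure.map_apply (hmX _ n) (measurable_prodMk_right hD)]
  exact measure_sum_range_mem_eq_zero hij (h.measurable_wait _) (h.law_wait i j hij)
    (h.iIndepFun_wait _) n t

theorem ae_isClockSystem [Countable ι] (h : IsEquilibriumInput μ K p η₀ W)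
    (hK : IsSymmTransitionMatrix K) :
    ∀ᵐ x ∂μ, IsClockSystem (ringTimes K fun s n => W s n x) := by
  have h1 : ∀ᵐ x ∂μ, ∀ i j k l, 0 < K i j → s(i, j) ≠ s(k, l) → ∀ n m,
      ringTime (fun s n => W s n x) s(i, j) n ≠ ringTime (fun s n => W s n x) s(k, l) m := by
    simp only [ae_all_iff]
    intro i j k l hij hne n m
    rw [ae_iff]
    simpa using h.measure_ringTime_eq hij hne n m
  filter_upwards [h1] with x hx
  refine ⟨fun j k => ?_, ?_⟩
  · simp only [ringTimes, hK.symm j k, Sym2.eq_swap (a := j) (b := k)]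
  · rintro j k l t ⟨hjk, n, rfl⟩ ⟨-, m, hm⟩
    by_contra hne
    exact hx j k j l hjk (fun h => hne (Sym2.congr_right.1 h)) n m hm

theorem measurable_ringsIn [Countable ι] (hK : IsSymmTransitionMatrix K) (a b : ℝ) (e : Sym2 ι) :
    Measurable fun W : Sym2 ι → ℕ → ℝ => ringsIn K a b W e := by
  induction e with | _ i j => ?_
  refine measurable_to_bool ?_
  refine MeasurableSet.congr (s := {_W | 0 < K i j} ∩ ⋃ n,
    (fun W : Sym2 ι → ℕ → ℝ => ringTime W s(i, j) n) ⁻¹' Set.Ioc a b) ?_ ?_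
  · exact (MeasurableSet.const _).inter (.iUnion fun n => measurable_ringTime _ n measurableSet_Ioc)
  · ext W
    simp only [Set.mem_preimage, Set.mem_singleton_iff, ringsIn_iff hK]
    simp

/-- The probability that the clock of the pair `e` rings in `(a, b]`. -/
noncomputable def ringProb (μ : Measure Ω) [IsProbabilityMeasure μ] (K : ι → ι → ℝ)
    (W : Sym2 ι → ℕ → Ω → ℝ) (a b : ℝ) (e : Sym2 ι) : unitInterval :=
  ⟨μ.real {x | ringsIn K a b (fun s n => W s n x) e = true}, measureReal_nonneg,
    measureReal_le_one⟩

/-- Each bit is a function of the waiting times of its own clock alone, so the bits inherit the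
independence of the clocks. -/
theorem map_ringsIn [Countable ι] (h : IsEquilibriumInput μ K p η₀ W)
    (hK : IsSymmTransitionMatrix K) (a b : ℝ) :
    μ.map (fun x => ringsIn K a b fun s n => W s n x) =
      bernoulliProduct (ringProb μ K W a b) := by
  have hm : ∀ e, Measurable fun x => ringsIn K a b (fun s n => W s n x) e :=
    fun e => (measurable_ringsIn hK a b e).comp h.measurable_waits
  have hloc : ∀ (V : Sym2 ι → ℕ → ℝ) e, ringsIn K a b V e = ringsIn K a b (fun _ => V e) e := by
    intro V e
    induction e with | _ i j => ?_
    rw [Bool.eq_iff_iff, ringsIn_iff hK, ringsIn_iff hK]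
    rfl
  have hind : iIndepFun (fun e x => ringsIn K a b (fun s n => W s n x) e) μ := by
    have h1 := h.iIndepFun_clocks.comp (fun e v => ringsIn K a b (fun _ => v) e) fun e =>
      (measurable_ringsIn hK a b e).comp (measurable_pi_lambda _ fun _ => measurable_id)
    refine h1.congr fun e => ae_of_all _ fun x => ?_
    exact (hloc (fun s n => W s n x) e).symm
  have h2 := (iIndepFun_iff_map_fun_eq_infinitePi_map hm).1 hind
  refine h2.trans ?_
  unfold bernoulliProduct
  congr 1
  funext e
  have : IsProbabilityMeasure (μ.map fun x => ringsIn K a b (fun s n => W s n x) e) :=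
    Measure.isProbabilityMeasure_map (hm e).aemeasurable
  refine eq_bernoulliMeasure ?_
  rw [Measure.map_apply (hm e) (measurableSet_singleton _)]
  exact (ofReal_measureReal (measure_ne_top _ _)).symm

/-- The probability of at least one ring is at most the expected number of rings. -/
theorem ringProb_le (h : IsEquilibriumInput μ K p η₀ W) (hK : IsSymmTransitionMatrix K)
    (a : ℝ) {δ : ℝ} (hδ : 0 ≤ δ) (i j : ι) :
    (ringProb μ K W a (a + δ) s(i, j) : ℝ) ≤ K i j * δ := by
  have h0 : 0 ≤ K i j * δ := mul_nonneg (hK.nonneg i j) hδ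
  change μ.real _ ≤ _
  by_cases hij : 0 < K i j
  · refine ENNReal.toReal_le_of_le_ofReal h0 ((measure_mono ?_).trans ((measure_iUnion_le _).trans
      (h.tsum_measure_ringTime_le hij a δ)))
    intro x hx
    obtain ⟨-, n, hn⟩ := (ringsIn_iff hK _ _ _ i j).1 hx
    exact Set.mem_iUnion.2 ⟨n, hn⟩
  · have : {x | ringsIn K a (a + δ) (fun s n => W s n x) s(i, j) = true} = ∅ := by
      ext x
      simp [ringsIn_iff hK, hij]
    rw [this, measureReal_empty]
    exact h0

theorem pairRateLe_ringProb (h : IsEquilibriumInput μ K p η₀ W) (hK : IsSymmTransitionMatrix K)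
    (a : ℝ) {δ : ℝ} (hδ : 0 ≤ δ) : PairRateLe (ringProb μ K W a (a + δ)) δ := by
  classical
  intro E i hE
  have hinj : Function.Injective fun k => s(i, k) := fun k k' h => Sym2.congr_right.1 h
  -- Pairs containing `i` are indexed by their other element, so that their rates are entries of row
  -- `i` of `K`.
  have hE' : E = (E.preimage (fun k => s(i, k)) hinj.injOn).image fun k => s(i, k) := by
    ext e
    simp only [Finset.mem_image, Finset.mem_preimage]
    constructor
    · intro he
      obtain ⟨k, rfl⟩ := hE e he
      exact ⟨k, he, rfl⟩
    · rintro ⟨k, hk, rfl⟩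
      exact hk
  rw [hE', Finset.sum_image hinj.injOn]
  calc ∑ k ∈ E.preimage (fun k => s(i, k)) hinj.injOn,
        (ringProb μ K W a (a + δ) s(i, k) : ℝ)
      ≤ ∑ k ∈ E.preimage (fun k => s(i, k)) hinj.injOn, K i k * δ :=
        Finset.sum_le_sum fun k _ => h.ringProb_le hK a hδ i k
    _ = (∑ k ∈ E.preimage (fun k => s(i, k)) hinj.injOn, K i k) * δ := (Finset.sum_mul _ _ _).symm
    _ ≤ 1 * δ := by
        gcongr
        exact sum_le_hasSum _ (fun k _ => hK.nonneg i k) (hK.hasSum_row i)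
    _ = δ := one_mul δ

theorem ae_isFiniteWindow [Countable ι] (h : IsEquilibriumInput μ K p η₀ W)
    (hK : IsSymmTransitionMatrix K) (a : ℝ) {δ : ℝ} (hδ : 0 ≤ δ) (hδ1 : δ < 1) :
    ∀ᵐ x ∂μ, IsFiniteWindow (ringTimes K fun s n => W s n x) a (a + δ) := by
  have hm : Measurable fun x => ringsIn K a (a + δ) fun s n => W s n x :=
    measurable_pi_lambda _ fun e => (measurable_ringsIn hK a _ e).comp h.measurable_waits
  have h1 := (h.pairRateLe_ringProb hK a hδ).ae_exists_finite hδ1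
  rw [← h.map_ringsIn hK] at h1
  filter_upwards [ae_of_ae_map hm.aemeasurable h1, h.ae_rings_finite a δ] with x hx hfin
  refine ⟨hfin, fun j => ?_⟩
  obtain ⟨C, hC, hj, hcl⟩ := hx j
  exact ⟨C, hC, hj, fun k hk l hl => hcl k hk l ((ringsIn_mk hK _ _ _ k l).2 hl)⟩

theorem ae_forall_exists_movesTo [Countable ι] (h : IsEquilibriumInput μ K p η₀ W)
    (hK : IsSymmTransitionMatrix K) {δ : ℝ} (hδ : 0 ≤ δ) (hδ1 : δ < 1) (n : ℕ) :
    ∀ᵐ x ∂μ, ∀ j, ∃ i, MovesTo (ringTimes K fun s n => W s n x) i (n * δ) j := by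
  have h1 : ∀ᵐ x ∂μ, ∀ m : ℕ, IsFiniteWindow (ringTimes K fun s n => W s n x) (m * δ)
      (m * δ + δ) := ae_all_iff.2 fun m => h.ae_isFiniteWindow hK _ hδ hδ1
  filter_upwards [h1, h.ae_isClockSystem hK] with x hx hR j
  refine exists_movesTo_of_isFiniteWindow hR hδ (fun m => ?_) n j
  rw [add_one_mul]
  exact hx m

end IsEquilibriumInput

/-! ### The exclusion process at equilibrium -/

/-- Injectivity alone suffices: distinct positions read distinct independent coordinates. It need
not be known that every particle has a position at time `t`. -/
theorem percMeasure_map_precomp {ι : Type*} (p : unitInterval) {f : ι → ι} (hf : f.Injective) :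
    (percMeasure ι p).map (fun η j => η (f j)) = percMeasure ι p :=
  Measure.map_infinitePi_infinitePi_of_inj (P := fun _ : ι => bernoulliMeasure true false p) hf

namespace IsEquilibriumInput

variable {ι Ω : Type*} [Countable ι] [MeasurableSpace Ω] {μ : Measure Ω} [IsProbabilityMeasure μ]
  {K : ι → ι → ℝ} {p : unitInterval} {η₀ : Ω → ι → Bool} {W : Sym2 ι → ℕ → Ω → ℝ}

/-- At every fixed time, the exclusion process has the law of percolation and is independent of the
clocks. -/
theorem map_exclusionProcess_waits (h : IsEquilibriumInput μ K p η₀ W)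
    (hK : IsSymmTransitionMatrix K) {t : ℝ}
    (ht : ∀ᵐ x ∂μ, ∀ j, ∃ i, MovesTo (ringTimes K fun s n => W s n x) i t j) :
    μ.map (fun x => (exclusionProcess K η₀ W t x, fun s n => W s n x)) =
      (percMeasure ι p).prod (μ.map fun x s n => W s n x) := by
  set L := μ.map fun x s n => W s n x
  have hL : IsProbabilityMeasure L := Measure.isProbabilityMeasure_map h.measurable_waits.aemeasurable
  let W' : Ω → Sym2 ι × ℕ → ℝ := fun x q => W q.1 q.2 x
  have hW' : Measurable W' := measurable_pi_lambda _ fun q => h.measurable_wait _ _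
  let c : (Sym2 ι × ℕ → ℝ) → Sym2 ι → ℕ → ℝ := fun v s n => v (s, n)
  have hc : Measurable c := measurable_pi_lambda _ fun s => measurable_pi_lambda _ fun n =>
    measurable_pi_apply _
  have hind : IndepFun η₀ (fun x s n => W s n x) μ := h.indep_init.comp measurable_id hc
  have hjoint := (indepFun_iff_map_prod_eq_prod_map_map h.measurable_init.aemeasurable
    h.measurable_waits.aemeasurable).1 hind
  rw [h.law_init] at hjoint
  let Φ : (ι → Bool) × (Sym2 ι → ℕ → ℝ) → (ι → Bool) × (Sym2 ι → ℕ → ℝ) :=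
    fun z => (exclusionState (ringTimes K z.2) z.1 t, z.2)
  have hΦ : Measurable Φ := (measurable_exclusionState K t).prodMk measurable_snd
  have e1 : (fun x => (exclusionProcess K η₀ W t x, fun s n => W s n x)) =
      Φ ∘ fun x => (η₀ x, fun s n => W s n x) := rfl
  rw [e1, ← Measure.map_map hΦ (h.measurable_init.prodMk h.measurable_waits), hjoint]
  symm
  refine Measure.prod_eq fun A D hA hD => ?_
  have hS : MeasurableSet {z : (ι → Bool) × (Sym2 ι → ℕ → ℝ) |
      exclusionState (ringTimes K z.2) z.1 t ∈ A} := measurable_exclusionState K t hA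
  -- For almost every fixed realization of the clocks the state at time `t` is the initial one
  -- precomposed with an injection, hence again percolation. This conditional law does not depend on
  -- the clocks, which gives independence from all of them.
  have hae : ∀ᵐ V ∂L, percMeasure ι p {η | exclusionState (ringTimes K V) η t ∈ A} =
      percMeasure ι p A := by
    refine (ae_map_iff h.measurable_waits.aemeasurable
      (measurableSet_eq_fun (measurable_measure_prodMk_right hS) measurable_const)).2 ?_
    filter_upwards [ht, h.ae_isClockSystem hK] with x hx hR
    obtain ⟨f, hf, hstate⟩ := exists_injective_exclusionState_eq hR hx
    have hm : Measurable fun (η : ι → Bool) j => η (f j) :=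
      measurable_pi_lambda _ fun j => measurable_pi_apply _
    conv_rhs => rw [← percMeasure_map_precomp p hf, Measure.map_apply hm hA]
    congr 1
    ext η
    have : exclusionState (ringTimes K fun s n => W s n x) η t = fun j => η (f j) :=
      funext fun j => hstate η j
    simp [this]
  rw [Measure.map_apply hΦ (hA.prod hD), Measure.prod_apply_symm (hΦ (hA.prod hD))]
  have h2 : ∀ᵐ V ∂L, percMeasure ι p ((fun η => (η, V)) ⁻¹' (Φ ⁻¹' (A ×ˢ D))) =
      D.indicator (fun _ => percMeasure ι p A) V := by
    filter_upwards [hae] with V hV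
    by_cases hVD : V ∈ D
    · rw [Set.indicator_of_mem hVD, ← hV]
      congr 1
      ext η
      simp [Φ, hVD]
    · rw [Set.indicator_of_notMem hVD]
      convert measure_empty
      · ext η
        simp [Φ, hVD]
      · infer_instance
  rw [lintegral_congr_ae h2, lintegral_indicator_const hD]

theorem map_exclusionProcess_ringsIn (h : IsEquilibriumInput μ K p η₀ W)
    (hK : IsSymmTransitionMatrix K) {t : ℝ}
    (ht : ∀ᵐ x ∂μ, ∀ j, ∃ i, MovesTo (ringTimes K fun s n => W s n x) i t j) (a b : ℝ) :
    μ.map (fun x => (exclusionProcess K η₀ W t x, ringsIn K a b fun s n => W s n x)) =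
      (percMeasure ι p).prod (bernoulliProduct (ringProb μ K W a b)) := by
  have hr : Measurable fun V : Sym2 ι → ℕ → ℝ => ringsIn K a b V :=
    measurable_pi_lambda _ fun e => measurable_ringsIn hK a b e
  have hX : Measurable fun x => exclusionProcess K η₀ W t x :=
    (measurable_exclusionState K t).comp (h.measurable_init.prodMk h.measurable_waits)
  have hp : IsProbabilityMeasure (μ.map fun x s n => W s n x) :=
    Measure.isProbabilityMeasure_map h.measurable_waits.aemeasurable
  rw [← h.map_ringsIn hK a b]
  have e1 : (fun x => (exclusionProcess K η₀ W t x, ringsIn K a b fun s n => W s n x)) =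
      Prod.map id (ringsIn K a b) ∘
        fun x => (exclusionProcess K η₀ W t x, fun s n => W s n x) := rfl
  have e2 : (fun x => ringsIn K a b fun s n => W s n x) =
      (ringsIn K a b) ∘ fun x s n => W s n x := rfl
  rw [e1, e2, ← Measure.map_map (measurable_id.prodMap hr) (hX.prodMk h.measurable_waits),
    h.map_exclusionProcess_waits hK ht, ← Measure.map_map hr h.measurable_waits,
    ← Measure.map_prod_map _ _ measurable_id hr, Measure.map_id]

/-- A property of the configuration at time `a` and of the pairs that ring in `(a, a + δ]` holds
almost surely for the process if it holds almost surely for independent random variables. -/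
theorem ae_of_ae_prod (h : IsEquilibriumInput μ K p η₀ W) (hK : IsSymmTransitionMatrix K) {δ : ℝ}
    (hδ : 0 ≤ δ) (hδ1 : δ < 1) {P : (ι → Bool) × (Sym2 ι → Bool) → Prop}
    (hP : ∀ r, PairRateLe r δ → ∀ᵐ z ∂(percMeasure ι p).prod (bernoulliProduct r), P z) (n : ℕ) :
    ∀ᵐ x ∂μ, P (exclusionProcess K η₀ W (n * δ) x,
      ringsIn K (n * δ) (n * δ + δ) fun s n => W s n x) := by
  have h1 := hP _ (h.pairRateLe_ringProb hK (n * δ) hδ)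
  rw [← h.map_exclusionProcess_ringsIn hK (h.ae_forall_exists_movesTo hK hδ hδ1 n)] at h1
  refine ae_of_ae_map (Measurable.aemeasurable ?_) h1
  refine Measurable.prodMk ?_ (measurable_pi_lambda _ fun e =>
    (measurable_ringsIn hK _ _ e).comp h.measurable_waits)
  exact (measurable_exclusionState K _).comp (h.measurable_init.prodMk h.measurable_waits)

end IsEquilibriumInput

/-! ### Comparison within a time window and conclusion. -/

theorem exclusionState_eq_or_exists_ringsIn {ι : Type*} {K : ι → ι → ℝ} (hK : IsSymmTransitionMatrix K)
    {V : Sym2 ι → ℕ → ℝ} (hR : IsClockSystem (ringTimes K V)) (η : ι → Bool) {a b t : ℝ}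
    (ha : 0 ≤ a) (hat : a ≤ t) (htb : t ≤ b) (j : ι) :
    exclusionState (ringTimes K V) η t j = exclusionState (ringTimes K V) η a j ∨
      ∃ e ∈ (Set.univ : Set (Sym2 ι)), ringsIn K a b V e = true ∧ j ∈ e := by
  by_cases hno : ∀ l, ∀ r ∈ ringTimes K V j l, ¬ (a < r ∧ r ≤ t)
  · exact Or.inl (exclusionState_eq_of_no_ring hR η ha hat hno)
  · push Not at hno
    obtain ⟨l, r, hr, h1, h2⟩ := hno
    exact Or.inr ⟨s(j, l), trivial, (ringsIn_mk hK _ _ _ _ _).2 ⟨r, hr, h1, h2.trans htb⟩,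
      Sym2.mem_mk_left j l⟩

theorem PairRateLe.mono {ι : Type*} {r : Sym2 ι → unitInterval} {δ δ' : ℝ} (h : PairRateLe r δ)
    (hδ : δ ≤ δ') : PairRateLe r δ' :=
  fun E i hE => (h E i hE).trans hδ

theorem exists_nat_mul_le_and_le {δ t : ℝ} (hδ : 0 < δ) (ht : 0 ≤ t) :
    ∃ n : ℕ, n * δ ≤ t ∧ t ≤ n * δ + δ := by
  refine ⟨⌊t / δ⌋₊, ?_, ?_⟩
  · exact (le_div_iff₀ hδ).1 (Nat.floor_le (by positivity))
  · rw [← add_one_mul]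
    exact ((div_lt_iff₀ hδ).1 (Nat.lt_floor_add_one (t / δ))).le

theorem IsPercolationEvent.noExceptionalTimes {ι : Type u} [Countable ι]
    {Inf : (ι → Bool) → Prop} (hInf : IsPercolationEvent Inf) {K : ι → ι → ℝ}
    (hK : IsSymmTransitionMatrix K) {p : unitInterval} (hp : (p : ℝ) ≠ criticalPoint Inf) :
    NoExceptionalTimes.{u, w} Inf K p := by
  intro Ω _ μ _ η₀ W h
  rcases lt_or_gt_of_ne hp with hlt | hgt
  · obtain ⟨hp0, δ₀, hδ₀, hrate⟩ := hInf.exists_rate_of_lt_criticalPoint hlt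
    -- The bound `δ₀` preserves the phase; the bound `1 / 2` keeps the graph of ringing pairs
    -- subcritical.
    have hδ : 0 < min δ₀ (1 / 2) := lt_min hδ₀ (by norm_num)
    have hδ1 : min δ₀ (1 / 2) < 1 := (min_le_right _ _).trans_lt (by norm_num)
    set δ := min δ₀ (1 / 2)
    have hall : ∀ᵐ x ∂μ, ∀ n : ℕ, _ := ae_all_iff.2 fun n => h.ae_of_ae_prod hK hδ.le hδ1
      (fun r hr => hrate r (hr.mono (min_le_left _ _))) n
    filter_upwards [hall, h.ae_isClockSystem hK] with x hx hR t ht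
    rintro (⟨-, hcl⟩ | ⟨h1, -⟩)
    · obtain ⟨n, hn, hn'⟩ := exists_nat_mul_le_and_le hδ ht
      -- The configuration at time `t` lies below the one at time `n * δ` with all ringing pairs
      -- opened, so an infinite cluster would persist there.
      refine hx n (hInf.isUpperSet ?_ hcl)
      intro j
      rcases exclusionState_eq_or_exists_ringsIn hK hR (η₀ x) (by positivity) hn hn' j with hj | hj
      · change exclusionState _ (η₀ x) t j ≤ _
        rw [hj]
        simp only [openPairs, exclusionProcess]
        exact Bool.left_le_or _ _
      · simp only [openPairs, hj, decide_true, Bool.or_true]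
        exact Bool.le_true _
    · rw [hp0] at h1
      exact zero_ne_one h1
  · obtain ⟨hp1, δ₀, hδ₀, hrate⟩ := hInf.exists_rate_of_criticalPoint_lt hgt
    have hδ : 0 < min δ₀ (1 / 2) := lt_min hδ₀ (by norm_num)
    have hδ1 : min δ₀ (1 / 2) < 1 := (min_le_right _ _).trans_lt (by norm_num)
    set δ := min δ₀ (1 / 2)
    have hall : ∀ᵐ x ∂μ, ∀ n : ℕ, _ := ae_all_iff.2 fun n => h.ae_of_ae_prod hK hδ.le hδ1
      (fun r hr => hrate r (hr.mono (min_le_left _ _))) n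
    filter_upwards [hall, h.ae_isClockSystem hK] with x hx hR t ht
    rintro (⟨h0, -⟩ | ⟨-, hcl⟩)
    · rw [hp1] at h0
      exact one_ne_zero h0
    · obtain ⟨n, hn, hn'⟩ := exists_nat_mul_le_and_le hδ ht
      -- Dually, the configuration at time `t` lies above the one at time `n * δ` with all elements
      -- of ringing pairs closed, which still percolates.
      refine hcl (hInf.isUpperSet ?_ (hx n))
      intro j
      rcases exclusionState_eq_or_exists_ringsIn hK hR (η₀ x) (by positivity) hn hn' j with hj | hj
      · change _ ≤ exclusionState _ (η₀ x) t j
        rw [hj]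
        simp only [openPairs, exclusionProcess, Bool.not_or, Bool.not_not]
        exact Bool.and_le_left _ _
      · simp only [openPairs, hj, decide_true, Bool.or_true, Bool.not_true]
        exact Bool.false_le _

end ExclusionPercolation

theorem proposition1p2 {V : Type u} [Infinite V] [Countable V] (G : SimpleGraph V)
    (hconn : G.Connected) (hfin : ∀ v, (G.neighborSet v).Finite) :
    (∀ K : G.edgeSet → G.edgeSet → ℝ, ExclusionPercolation.IsSymmTransitionMatrix K →
      ∀ p : unitInterval,
        (p : ℝ) ≠ ExclusionPercolation.criticalPoint
          (ExclusionPercolation.HasInfiniteBondCluster G) →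
        ExclusionPercolation.NoExceptionalTimes.{u, w}
          (ExclusionPercolation.HasInfiniteBondCluster G) K p) ∧
    (∀ K : V → V → ℝ, ExclusionPercolation.IsSymmTransitionMatrix K →
      ∀ p : unitInterval,
        (p : ℝ) ≠ ExclusionPercolation.criticalPoint
          (ExclusionPercolation.HasInfiniteSiteCluster G) →
        ExclusionPercolation.NoExceptionalTimes.{u, w}
          (ExclusionPercolation.HasInfiniteSiteCluster G) K p) := by
  exact ⟨fun _ hK _ hp =>
      (ExclusionPercolation.isPercolationEvent_bond hfin).noExceptionalTimes hK hp,
    fun _ hK _ hp =>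
      (ExclusionPercolation.isPercolationEvent_site hfin).noExceptionalTimes hK hp⟩
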